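/- **Language.** Terms $M,N$ and values $V,W,Z$ are given (up to renaming of bound variables) by $$M ::= V \mid V\,W \mid \mathsf{let}\ x=M\ \mathsf{in}\ N \mid M\oplus_p N \mid \mathsf{case}\ V\ \mathsf{of}\ \{\mathsf S\to W\mid \mathsf 0\to Z\},\qquad V ::= x\mid \mathsf 0\mid \mathsf S\,V\mid \lambda x.M\mid \mathsf{letrec}\ f=V,$$ with $p\in(0,1)$. A distribution on $X$ is a function $\mathscr D:X\to[0,1]$ with sum $\sum\mathscr D=\sum_{x}\mathscr D(x)\le 1$; $\{x_i^{p_i}\mid i\in I\}$ denotes the distribution with support the pairwise distinct $x_i$ and $p_i=\mathscr D(x_i)>0$. Call-by-value reduction $\to_v$ of non-value terms is given by $\mathsf{let}\ x=V\ \mathsf{in}\ M\to_v\{M[V/x]^1\}$; $(\lambda x.M)V\to_v\{M[V/x]^1\}$; $M\oplus_pN\to_v p\cdot\{M^1\}+(1-p)\cdot\{N^1\}$; $\mathsf{case}\ \mathsf S V\ \mathsf{of}\ \{\mathsf S\to W\mid\mathsf 0\to Z\}\to_v\{(W\,V)^1\}$; $\mathsf{case}\ \mathsf 0\ \mathsf{of}\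 \{\mathsf S\to W\mid\mathsf 0\to Z\}\to_v\{Z^1\}$; $(\mathsf{letrec}\ f=V)\,W\to_v\{(V[(\mathsf{letrec}\ f=V)/f]\,W)^1\}$ if $W$ is $\mathsf 0$ or of the form $\mathsf S W'$; and if $M\to_v\{L_i^{p_i}\}$ then $\mathsf{let}\ x=M\ \mathsf{in}\ N\to_v\{(\mathsf{let}\ x=L_i\ \mathsf{in}\ N)^{p_i}\}$. A term distribution splits as $\mathscr D=\mathscr D_{|V}+\mathscr D_{|T}$ into its parts on values and on non-values; $\mathscr D\to_v\sum_M\mathscr D_{|T}(M)\cdot\mathscr E_M+\mathscr D_{|V}$ whenever $M\to_v\mathscr E_M$ for all $M$ in the support of $\mathscr D_{|T}$. The semantics $[\![M]\!]$ is the pointwise supremum of the distributions $\mathscr E_{|V}$ with $\{M^1\}\to_v^n\mathscr E$ for some $n\in\mathbb N$. $M$ is *almost surely terminating* (AST) if $\sum[\![M]\!]=1$. **Types.** Sizes are $\mathfrak s::=\mathfrak i\mid\infty\mid\hat{\mathfrak s}$ ($\mathfrak i$ a size variable) modulo $\hat\infty=\infty$; so a size is $\infty$ or a $k$-fold successor $\hat{\mathfrak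 i}^k$ of a variable, called its spine. The order $\preccurlyeq$ on sizes is the least preorder with $\mathfrak s\preccurlyeq\hat{\mathfrak s}$ and $\mathfrak s\preccurlyeq\infty$. Sized types $\sigma$ and distribution types $\mu$ are $\sigma::=\mathsf{Nat}^{\mathfrak s}\mid\sigma\to\mu$ and $\mu::=\{\sigma_i^{p_i}\mid i\in I\}$, with $I$ finite and non-empty, $\sum_ip_i\le1$ and all $\sigma_i$ having the same underlying simple type, where underlying simple types $\langle\sigma\rangle,\langle\mu\rangle$ are obtained by erasing sizes and replacing a distribution by its common simple type. We write $\sigma$ for $\{\sigma^1\}$ and $\mu\oplus_p\nu=p\mu+(1-p)\nu$. Size substitution $[\mathfrak r/\mathfrak i]$ acts pointwise (weights of types that become equal are added). Subtyping $\sqsubseteq$ is reflexive; $\mathsf{Nat}^{\mathfrak s}\sqsubseteq\mathsf{Nat}^{\mathfrak r}$ if $\mathfrak s\preccurlyeq\mathfrak r$; $\sigma\to\mu\sqsubseteq\tau\to\nu$ if $\tau\sqsubseteq\sigma$ and $\mu\sqsubseteq\nu$; $\{\sigma_i^{p_i}\mid i\in I\}\sqsubseteq\{\tau_j^{q_j}\mid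 j\in J\}$ if there is $f:I\to J$ with $\sigma_i\sqsubseteq\tau_{f(i)}$ for all $i$ and $\sum_{i\in f^{-1}(j)}p_i\le q_j$ for all $j$. The variable $\mathfrak i$ is always positive in $\mathsf{Nat}^{\mathfrak s}$, and negative in it iff it does not occur in $\mathfrak s$; it is positive (negative) in $\sigma\to\mu$ iff it is negative (positive) in $\sigma$ and positive (negative) in $\mu$, and positive (negative) in $\{\sigma_i^{p_i}\}$ iff it is so in every $\sigma_i$. **Sized walks.** Finitely many weights $p_k$ ($k\in I\subset\mathbb N$) with $\sum_kp_k\le1$ define a Markov chain on $\mathbb N$: $0$ is stationary, and from $s+1$ one moves to $s+k$ with probability $p_k$, and to $0$ with the remaining probability $1-\sum_kp_k$. It is AST if it reaches $0$ with probability $1$ from every initial state. $\{(\mathsf{Nat}^{\mathfrak s_j}\to\nu_j)^{p_j}\}$ with $\mathfrak s_j=\hat{\mathfrak i}^{k_j}$ induces the walk in which $k_j$ has weight $p_j$. **Typing.** A context $\Gamma\mid\Theta$ consists of a finite assignment $\Gamma$ of sized types to variables and of a $\Theta$ that is empty or assigns a distribution type to one variable outside the domain of $\Gamma$. "$\Gamma,\Delta$"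 denotes union of contexts with disjoint domains, "$\Theta,\Psi$" requires $\Theta$ or $\Psi$ to be empty, and $\langle\Gamma\rangle=\mathsf{Nat}$ means that all types in $\Gamma$ are of the form $\mathsf{Nat}^{\mathfrak s}$. $\Theta\oplus_p\Psi$ is $x:\mu\oplus_p\nu$ for $\Theta=x:\mu$, $\Psi=x:\nu$ with $\langle\mu\rangle=\langle\nu\rangle$; it is $x:p\mu$ for $\Theta=x:\mu$, $\Psi=\emptyset$; $x:(1-p)\nu$ for $\Theta=\emptyset$, $\Psi=x:\nu$; $\emptyset$ for $\Theta=\Psi=\emptyset$; undefined otherwise. $\sum_ip_i\Psi_i$ is $x:\sum_ip_i\mu_i$ if $\Psi_i=x:\mu_i$ for all $i$, with the same $x$ and the same $\langle\mu_i\rangle$; it is $\emptyset$ if all $\Psi_i$ are empty; undefined otherwise. The judgements $\Gamma\mid\Theta\vdash M:\mu$ are generated by the following rules (all contexts being well formed): * $\Gamma,x:\sigma\mid\Theta\vdash x:\sigma$; $\ \Gamma\mid x:\sigma\vdash x:\sigma$; $\ \Gamma\mid\Theta\vdash\mathsf 0:\mathsf{Nat}^{\hat{\mathfrak s}}$; *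 if $\Gamma\mid\Theta\vdash V:\mathsf{Nat}^{\mathfrak s}$ then $\Gamma\mid\Theta\vdash\mathsf S\,V:\mathsf{Nat}^{\hat{\mathfrak s}}$; * if $\Gamma,x:\sigma\mid\Theta\vdash M:\mu$ then $\Gamma\mid\Theta\vdash\lambda x.M:\sigma\to\mu$; * if $\Gamma\mid\Theta\vdash M:\mu$ and $\mu\sqsubseteq\nu$ then $\Gamma\mid\Theta\vdash M:\nu$; * if $\Gamma,\Delta\mid\Theta\vdash V:\sigma\to\mu$, $\Gamma,\Xi\mid\Psi\vdash W:\sigma$ and $\langle\Gamma\rangle=\mathsf{Nat}$ then $\Gamma,\Delta,\Xi\mid\Theta,\Psi\vdash V\,W:\mu$; * if $\Gamma\mid\Theta\vdash M:\mu$, $\Gamma\mid\Psi\vdash N:\nu$ and $\langle\mu\rangle=\langle\nu\rangle$ then $\Gamma\mid\Theta\oplus_p\Psi\vdash M\oplus_pN:\mu\oplus_p\nu$; * if $\Gamma,\Delta\mid\Theta\vdash M:\{\sigma_i^{p_i}\mid i\in I\}$, $\langle\Gamma\rangle=\mathsf{Nat}$ and $\Gamma,\Xi,x:\sigma_i\mid\Psi_i\vdash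 N:\mu_i$ for all $i\in I$ (the $\mu_i$ having the same underlying simple type) then $\Gamma,\Delta,\Xi\mid\Theta,(\sum_ip_i\Psi_i)\vdash\mathsf{let}\ x=M\ \mathsf{in}\ N:\sum_ip_i\mu_i$; * if $\Gamma\mid\emptyset\vdash V:\mathsf{Nat}^{\hat{\mathfrak s}}$, $\Delta\mid\Theta\vdash W:\mathsf{Nat}^{\mathfrak s}\to\mu$ and $\Delta\mid\Theta\vdash Z:\mu$ then $\Gamma,\Delta\mid\Theta\vdash\mathsf{case}\ V\ \mathsf{of}\ \{\mathsf S\to W\mid\mathsf 0\to Z\}:\mu$; * if $\langle\Gamma\rangle=\mathsf{Nat}$, $\mathfrak i$ does not occur in $\Gamma$, $\mathfrak i$ is positive in $\nu$, every $\mathfrak s_j$ has spine $\mathfrak i$, $\mu=\{(\mathsf{Nat}^{\mathfrak s_j}\to\nu[\mathfrak s_j/\mathfrak i])^{p_j}\mid j\in J\}$ induces an AST sized walk, and $\Gamma\mid f:\mu\vdash V:\mathsf{Nat}^{\hat{\mathfrak i}}\to\nu[\hat{\mathfrak i}/\mathfrak i]$, then $\Gamma,\Delta\mid\Theta\vdash\mathsf{letrec}\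 f=V:\mathsf{Nat}^{\mathfrak r}\to\nu[\mathfrak r/\mathfrak i]$ for every size $\mathfrak r$. **Theorem.** If $M$ is a closed term and $\emptyset\mid\emptyset\vdash M:\mu$ for some distribution type $\mu$, then $M$ is almost surely terminating, i.e. $\sum[\![M]\!]=1$. -/

import Mathlib

open scoped NNReal ENNReal

namespace MAST

noncomputable section

/-! ## The language -/

/- Terms and values with `n` variables in scope, up to renaming of bound variables: variables are
de Bruijn indices in `Fin n`, and `letin`, `lam`, `letrec` bind the variable `0` of their body. -/
mutual

/-- Terms `M, N ::= V | V W | let x = M in N | M ⊕_p N | case V of {S → W | 0 → Z}`,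
where `0 < p < 1`. -/
inductive Term : ℕ → Type where
  | val {n : ℕ} (V : Value n) : Term n
  | app {n : ℕ} (V W : Value n) : Term n
  | letin {n : ℕ} (M : Term n) (N : Term (n + 1)) : Term n
  | choice {n : ℕ} (p : Set.Ioo (0 : ℝ≥0) 1) (M N : Term n) : Term n
  | case {n : ℕ} (V W Z : Value n) : Term n

/-- Values `V, W, Z ::= x | 0 | S V | λx.M | letrec f = V`. -/
inductive Value : ℕ → Type where
  | var {n : ℕ} (x : Fin n) : Value n
  | zero {n : ℕ} : Value n
  | succ {n : ℕ} (V : Value n) : Value n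
  | lam {n : ℕ} (M : Term (n + 1)) : Value n
  | letrec {n : ℕ} (V : Value (n + 1)) : Value n

end

/-- Extension of a renaming below a binder. -/
def liftRen {n m : ℕ} (r : Fin n → Fin m) : Fin (n + 1) → Fin (m + 1) :=
  Fin.cases 0 (fun x => (r x).succ)

mutual

/-- Renaming of the variables of a term. -/
def Term.rename {n m : ℕ} : Term n → (Fin n → Fin m) → Term m
  | .val V, r => .val (V.rename r)
  | .app V W, r => .app (V.rename r) (W.rename r)
  | .letin M N, r => .letin (M.rename r) (N.rename (liftRen r))
  | .choice p M N, r => .choice p (M.rename r) (N.rename r)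
  | .case V W Z, r => .case (V.rename r) (W.rename r) (Z.rename r)

/-- Renaming of the variables of a value. -/
def Value.rename {n m : ℕ} : Value n → (Fin n → Fin m) → Value m
  | .var x, r => .var (r x)
  | .zero, _ => .zero
  | .succ V, r => .succ (V.rename r)
  | .lam M, r => .lam (M.rename (liftRen r))
  | .letrec V, r => .letrec (V.rename (liftRen r))

end

/-- Extension of a substitution below a binder. -/
def liftSub {n m : ℕ} (s : Fin n → Value m) : Fin (n + 1) → Value (m + 1) :=
  Fin.cases (.var 0) (fun x => (s x).rename Fin.succ)

mutual

/-- Simultaneous capture-avoiding substitution of values for the variables of a term. -/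
def Term.subst {n m : ℕ} : Term n → (Fin n → Value m) → Term m
  | .val V, s => .val (V.subst s)
  | .app V W, s => .app (V.subst s) (W.subst s)
  | .letin M N, s => .letin (M.subst s) (N.subst (liftSub s))
  | .choice p M N, s => .choice p (M.subst s) (N.subst s)
  | .case V W Z, s => .case (V.subst s) (W.subst s) (Z.subst s)

/-- Simultaneous capture-avoiding substitution of values for the variables of a value. -/
def Value.subst {n m : ℕ} : Value n → (Fin n → Value m) → Value m
  | .var x, s => s x
  | .zero, _ => .zero
  | .succ V, s => .succ (V.subst s)
  | .lam M, s => .lam (M.subst (liftSub s))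
  | .letrec V, s => .letrec (V.subst (liftSub s))

end

/-- The substitution of `V` for the variable `0`. -/
def single {n : ℕ} (V : Value n) : Fin (n + 1) → Value n :=
  Fin.cases V .var

/-- `M[V/x]`, where `x` is the variable `0`. -/
def Term.inst {n : ℕ} (M : Term (n + 1)) (V : Value n) : Term n :=
  M.subst (single V)

/-- `W[V/x]`, where `x` is the variable `0`. -/
def Value.inst {n : ℕ} (W : Value (n + 1)) (V : Value n) : Value n :=
  W.subst (single V)

/-- The term is a value. -/
def Term.IsValue {n : ℕ} (M : Term n) : Prop :=
  ∃ V : Value n, M = .val V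

/-- The value is `0` or of the form `S V`. -/
inductive Value.IsConstr {n : ℕ} : Value n → Prop where
  | zero : Value.IsConstr .zero
  | succ (V : Value n) : Value.IsConstr (.succ V)

/-! ## Distributions and operational semantics

A distribution on `X` is a function `D : X → ℝ≥0∞` with `distrSum D ≤ 1`. -/

/-- The sum of a distribution. -/
def distrSum {X : Type} (D : X → ℝ≥0∞) : ℝ≥0∞ := ∑' x, D x

open Classical in
/-- The Dirac distribution `{x¹}`. -/
def dirac {X : Type} (x : X) : X → ℝ≥0∞ := fun y => if y = x then 1 else 0

open Classical in
/-- The distribution `{(f xᵢ)^{pᵢ} | i}`, where `D = {xᵢ^{pᵢ} | i}`. -/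
def pushforward {X Y : Type} (f : X → Y) (D : X → ℝ≥0∞) : Y → ℝ≥0∞ :=
  fun y => ∑' x, if f x = y then D x else 0

/-- The part `D_{|V}` of the value decomposition of a term distribution. -/
def valuePart {n : ℕ} (D : Term n → ℝ≥0∞) : Term n → ℝ≥0∞ :=
  Set.indicator {M | M.IsValue} D

/-- The part `D_{|T}` of the value decomposition of a term distribution. -/
def termPart {n : ℕ} (D : Term n → ℝ≥0∞) : Term n → ℝ≥0∞ :=
  Set.indicator {M | ¬ M.IsValue} D

/-- Call-by-value reduction `M →_v E` of a term (which is not a value) to a distribution. -/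
inductive Step {n : ℕ} : Term n → (Term n → ℝ≥0∞) → Prop where
  | let_value (V : Value n) (M : Term (n + 1)) :
      Step (.letin (.val V) M) (dirac (M.inst V))
  | beta (M : Term (n + 1)) (V : Value n) :
      Step (.app (.lam M) V) (dirac (M.inst V))
  | choice (p : Set.Ioo (0 : ℝ≥0) 1) (M N : Term n) :
      Step (.choice p M N)
        (((p : ℝ≥0) : ℝ≥0∞) • dirac M + ((1 - (p : ℝ≥0) : ℝ≥0) : ℝ≥0∞) • dirac N)
  | let_step (M : Term n) (N : Term (n + 1)) (E : Term n → ℝ≥0∞) :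
      Step M E → Step (.letin M N) (pushforward (fun L => .letin L N) E)
  | case_succ (V W Z : Value n) :
      Step (.case (.succ V) W Z) (dirac (.app W V))
  | case_zero (W Z : Value n) :
      Step (.case .zero W Z) (dirac (.val Z))
  | unfold (V : Value (n + 1)) (W : Value n) :
      W.IsConstr → Step (.app (.letrec V) W) (dirac (.app (V.inst (.letrec V)) W))

/-- Call-by-value reduction `D →_v E` of a term distribution: every term `M` of the support of
`D` that is not a value reduces to some `F M`, and `E = ∑_M D_{|T}(M) · F M + D_{|V}`. -/
def DistStep {n : ℕ} (D E : Term n → ℝ≥0∞) : Prop :=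
  ∃ F : Term n → (Term n → ℝ≥0∞),
    (∀ M, termPart D M ≠ 0 → Step M (F M)) ∧
      E = fun L => (∑' M, termPart D M * F M L) + valuePart D L

/-- The `k`-th iterate `→_v^k` of the reduction relation. -/
def DistSteps {n : ℕ} : ℕ → (Term n → ℝ≥0∞) → (Term n → ℝ≥0∞) → Prop
  | 0, D, E => E = D
  | k + 1, D, E => ∃ D', DistStep D D' ∧ DistSteps k D' E

/-- The relation `D ⇛_v^k E`: `E` is the value part of a distribution `E'` with `D →_v^k E'`. -/
def ValSteps {n : ℕ} (k : ℕ) (D E : Term n → ℝ≥0∞) : Prop :=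
  ∃ E', DistSteps k D E' ∧ E = valuePart E'

/-- The semantics `⟦D⟧` of a term distribution, the (pointwise) supremum of the distributions `E`
with `D ⇛_v^k E` for some `k`. -/
def semantics {n : ℕ} (D : Term n → ℝ≥0∞) : Term n → ℝ≥0∞ :=
  sSup {E | ∃ k, ValSteps k D E}

/-- The term `M` is almost-surely terminating: the sum of `⟦M⟧` is `1`. -/
def Term.IsAST {n : ℕ} (M : Term n) : Prop :=
  distrSum (semantics (dirac M)) = 1

/-! ## Sizes -/

/-- Sizes `s ::= i | ∞ | ŝ` modulo `∞̂ = ∞`; size variables are natural numbers. Every class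
contains exactly one of `∞` and the iterated successors `î^k` of a variable `i`; the latter is
`var i k`. -/
inductive Size : Type where
  | var (i : ℕ) (k : ℕ) : Size
  | infty : Size

/-- The successor `ŝ` of a size. -/
def Size.succ : Size → Size
  | .var i k => .var i (k + 1)
  | .infty => .infty

/-- The spine variable of a size, if there is one. -/
def Size.spine : Size → Option ℕ
  | .var i _ => some i
  | .infty => none

/-- The number `k` of successors in a size `î^k` (and `0` for `∞`). -/
def Size.height : Size → ℕ
  | .var _ k => k
  | .infty => 0

/-- The order `s ≼ r` on sizes. -/
inductive Size.Le : Size → Size → Prop where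
  | refl (s : Size) : Size.Le s s
  | trans {s r t : Size} : Size.Le s r → Size.Le r t → Size.Le s t
  | succ (s : Size) : Size.Le s s.succ
  | infty (s : Size) : Size.Le s .infty

/-- The substitution `s[r/i]`. -/
def Size.subst (i : ℕ) (r : Size) : Size → Size
  | .var j k => if j = i then Size.succ^[k] r else .var j k
  | .infty => .infty

/-! ## Finite distributions and types -/

/-- Finite distributions `{xᵢ^{pᵢ} | i ∈ I}` on `X` with non-empty support. -/
structure FinDist (X : Type) : Type where
  w : X →₀ ℝ≥0
  sum_le_one : ∑ x ∈ w.support, w x ≤ 1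
  ne_zero : w ≠ 0

namespace FinDist

variable {X Y : Type}

theorem degree_le (μ : FinDist X) : μ.w.degree ≤ 1 := μ.sum_le_one

theorem degree_ne (μ : FinDist X) : μ.w.degree ≠ 0 := by
  rw [Ne, Finsupp.degree_eq_zero_iff]
  exact μ.ne_zero

theorem degree_smul (p : ℝ≥0) (f : X →₀ ℝ≥0) : (p • f).degree = p * f.degree := by
  have h := Finsupp.sum_smul_index (b := p) (g := f) (h := fun _ a => a) (fun _ => rfl)
  simpa only [Finsupp.sum, ← Finset.mul_sum, Finsupp.degree_apply] using h

theorem degree_bind (f : X →₀ ℝ≥0) (g : X → Y →₀ ℝ≥0) :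
    (f.sum fun x a => a • g x).degree = ∑ x ∈ f.support, f x * (g x).degree := by
  simp only [Finsupp.sum, map_sum, degree_smul]

/-- A finitely supported function of positive total weight at most `1`. -/
def ofDegree (f : X →₀ ℝ≥0) (h1 : f.degree ≤ 1) (h0 : f.degree ≠ 0) : FinDist X where
  w := f
  sum_le_one := h1
  ne_zero := fun h => h0 (by rw [h, map_zero])

/-- The Dirac distribution `{x¹}`. -/
def pure (x : X) : FinDist X :=
  ofDegree (Finsupp.single x 1) (by simp) (by simp)

/-- The product `p · μ`, for `0 < p ≤ 1`. -/
def scale (p : ℝ≥0) (h0 : 0 < p) (h1 : p ≤ 1) (μ : FinDist X) : FinDist X :=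
  ofDegree (p • μ.w)
    (by rw [degree_smul]; exact mul_le_one' h1 μ.degree_le)
    (by rw [degree_smul]; exact mul_ne_zero h0.ne' μ.degree_ne)

/-- The probabilistic sum `μ ⊕_p ν = p · μ + (1 - p) · ν`. -/
def psum (p : Set.Ioo (0 : ℝ≥0) 1) (μ ν : FinDist X) : FinDist X :=
  ofDegree ((p : ℝ≥0) • μ.w + (1 - (p : ℝ≥0)) • ν.w)
    (by
      rw [map_add, degree_smul, degree_smul]
      calc (p : ℝ≥0) * μ.w.degree + (1 - (p : ℝ≥0)) * ν.w.degree
          ≤ (p : ℝ≥0) * 1 + (1 - (p : ℝ≥0)) * 1 := by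
            gcongr
            · exact μ.degree_le
            · exact ν.degree_le
        _ = 1 := by rw [mul_one, mul_one, add_tsub_cancel_of_le p.2.2.le])
    (by
      rw [map_add, degree_smul, degree_smul]
      have h := mul_ne_zero p.2.1.ne' μ.degree_ne
      positivity)

/-- The image `{(f xᵢ)^{pᵢ} | i}` of `μ = {xᵢ^{pᵢ} | i}`; equal images have their weights added. -/
def map (f : X → Y) (μ : FinDist X) : FinDist Y :=
  ofDegree (μ.w.mapDomain f)
    (by rw [Finsupp.degree_mapDomain]; exact μ.degree_le)
    (by rw [Finsupp.degree_mapDomain]; exact μ.degree_ne)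

/-- The weighted sum `∑ᵢ pᵢ · νᵢ`, where `μ = {xᵢ^{pᵢ} | i}` and `νᵢ = ν xᵢ`. -/
def bind (μ : FinDist X) (ν : X → FinDist Y) : FinDist Y :=
  ofDegree (μ.w.sum fun x a => a • (ν x).w)
    (by
      rw [degree_bind]
      refine le_trans (Finset.sum_le_sum fun x _ => ?_) μ.sum_le_one
      exact mul_le_of_le_one_right zero_le (ν x).degree_le)
    (by
      rw [degree_bind]
      intro h
      obtain ⟨x, hx⟩ := Finsupp.support_nonempty_iff.mpr μ.ne_zero
      have h2 := (Finset.sum_eq_zero_iff.mp h) x hx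
      exact mul_ne_zero (Finsupp.mem_support_iff.mp hx) (ν x).degree_ne h2)

end FinDist

/-- Simple types `κ ::= Nat | κ → κ'`. -/
inductive SimpleTy : Type where
  | nat : SimpleTy
  | arr (κ κ' : SimpleTy) : SimpleTy

/-- The sized types `σ ::= Nat^s | σ → μ` with underlying simple type `κ`. Here `μ` is a
distribution type, that is a finite distribution of sized types which all have the same
underlying simple type. -/
def SizedTy : SimpleTy → Type
  | .nat => Size
  | .arr κ κ' => SizedTy κ × FinDist (SizedTy κ')

/-- The distribution types with underlying simple type `κ`. -/
abbrev DistTy (κ : SimpleTy) : Type := FinDist (SizedTy κ)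

/-- The sized type `Nat^s`. -/
def SizedTy.nat (s : Size) : SizedTy .nat := s

/-- The sized type `σ → μ`. -/
def SizedTy.arrow {κ κ' : SimpleTy} (σ : SizedTy κ) (μ : DistTy κ') : SizedTy (.arr κ κ') :=
  (σ, μ)

/-- The substitution `σ[r/i]`. -/
def SizedTy.subst (i : ℕ) (r : Size) : {κ : SimpleTy} → SizedTy κ → SizedTy κ
  | .nat, s => Size.subst i r s
  | .arr _ _, (σ, μ) => (SizedTy.subst i r σ, μ.map (SizedTy.subst i r))

/-- The substitution `μ[r/i]`. -/
def DistTy.subst {κ : SimpleTy} (i : ℕ) (r : Size) (μ : DistTy κ) : DistTy κ :=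
  μ.map (SizedTy.subst i r)

/-- The size variable `i` does not occur in `σ`. -/
def SizedTy.Fresh (i : ℕ) : {κ : SimpleTy} → SizedTy κ → Prop
  | .nat, s => Size.spine s ≠ some i
  | .arr _ _, (σ, μ) => SizedTy.Fresh i σ ∧ ∀ τ ∈ μ.w.support, SizedTy.Fresh i τ

mutual

/-- The size variable `i` is positive in `σ`. -/
def SizedTy.Pos (i : ℕ) : {κ : SimpleTy} → SizedTy κ → Prop
  | .nat, _ => True
  | .arr _ _, (σ, μ) => SizedTy.Neg i σ ∧ ∀ τ ∈ μ.w.support, SizedTy.Pos i τ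

/-- The size variable `i` is negative in `σ`. -/
def SizedTy.Neg (i : ℕ) : {κ : SimpleTy} → SizedTy κ → Prop
  | .nat, s => Size.spine s ≠ some i
  | .arr _ _, (σ, μ) => SizedTy.Pos i σ ∧ ∀ τ ∈ μ.w.support, SizedTy.Neg i τ

end

/-- The size variable `i` is positive in `μ`. -/
def DistTy.Pos {κ : SimpleTy} (i : ℕ) (μ : DistTy κ) : Prop :=
  ∀ σ ∈ μ.w.support, SizedTy.Pos i σ

/-- The lifting of a relation to finite distributions: `{xᵢ^{pᵢ} | i ∈ I}` and
`{yⱼ^{qⱼ} | j ∈ J}` are related when there is a map `f : I → J` with `R xᵢ y_{f(i)}` for all `i`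
and `∑_{i ∈ f⁻¹(j)} pᵢ ≤ qⱼ` for all `j`. -/
def FinDist.Lift {X : Type} (R : X → X → Prop) (μ ν : FinDist X) : Prop :=
  ∃ f : X → X, (∀ x ∈ μ.w.support, f x ∈ ν.w.support ∧ R x (f x)) ∧
    ∀ y ∈ ν.w.support, (μ.map f).w y ≤ ν.w y

/-- Subtyping `σ ⊑ τ` of sized types. -/
def SizedTy.Sub : {κ : SimpleTy} → SizedTy κ → SizedTy κ → Prop
  | .nat, s, r => Size.Le s r
  | .arr _ _, (σ, μ), (τ, ν) => SizedTy.Sub τ σ ∧ FinDist.Lift SizedTy.Sub μ ν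

/-- Subtyping `μ ⊑ ν` of distribution types. -/
def DistTy.Sub {κ : SimpleTy} (μ ν : DistTy κ) : Prop :=
  FinDist.Lift SizedTy.Sub μ ν

/-! ## Sized walks -/

/-- The law of the jump of a sized walk with parameters `(pᵢ)ᵢ`: `some i` has probability `pᵢ`,
and `none` has the remaining probability `1 - ∑ᵢ pᵢ`. -/
def walkJump (w : FinDist ℕ) : PMF (Option ℕ) :=
  ⟨fun o => ((o.elim (1 - ∑ i ∈ w.w.support, w.w i) (fun i => w.w i) : ℝ≥0) : ℝ≥0∞), by
    have h : ∑ o ∈ w.w.support.insertNone,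
        (o.elim (1 - ∑ i ∈ w.w.support, w.w i) (fun i => w.w i) : ℝ≥0) = 1 := by
      rw [Finset.sum_insertNone]
      exact tsub_add_cancel_of_le w.sum_le_one
    have h2 := hasSum_sum_of_ne_finset_zero (L := .unconditional _) (s := w.w.support.insertNone)
      (f := fun o : Option ℕ =>
        (o.elim (1 - ∑ i ∈ w.w.support, w.w i) (fun i => w.w i) : ℝ≥0)) (by
          intro o ho
          cases o with
          | none => simp at ho
          | some i => simpa using ho)
    rw [h] at h2
    rw [← ENNReal.coe_one]
    exact ENNReal.hasSum_coe.mpr h2⟩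

/-- The transition probabilities of the sized walk with parameters `(pᵢ)ᵢ`: `0` is stationary;
from `s + 1` the walk moves to `s + i` with probability `pᵢ`, and to `0` with the remaining
probability `1 - ∑ᵢ pᵢ`. -/
def walkStep (w : FinDist ℕ) : ℕ → PMF ℕ
  | 0 => PMF.pure 0
  | s + 1 => (walkJump w).map fun o => o.elim 0 (fun i => s + i)

/-- The law of the position of the sized walk after `k` steps, started from `m`. -/
def walkLaw (w : FinDist ℕ) : ℕ → ℕ → PMF ℕ
  | 0, m => PMF.pure m
  | k + 1, m => (walkStep w m).bind (walkLaw w k)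

/-- The sized walk reaches `0` with probability `1` from any initial state. As `0` is stationary,
`walkLaw w k m 0` is the probability that `0` is reached from `m` in at most `k` steps. -/
def WalkAST (w : FinDist ℕ) : Prop :=
  ∀ m : ℕ, ⨆ k : ℕ, walkLaw w k m 0 = 1

/-- The argument size `s` of a sized type `Nat^s → ν`. -/
def SizedTy.argSize {κ : SimpleTy} (σ : SizedTy (.arr .nat κ)) : Size := σ.1

/-- The parameters of the sized walk induced by `{(Nat^{sⱼ} → νⱼ)^{pⱼ} | j}`, where
`sⱼ = î^{kⱼ}`: the integer `kⱼ` receives the probability `pⱼ`. -/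
def DistTy.inducedWalk {κ : SimpleTy} (μ : DistTy (.arr .nat κ)) : FinDist ℕ :=
  μ.map fun σ => σ.argSize.height

/-! ## Contexts -/

/-- Sized types, of any underlying simple type. -/
abbrev AnySizedTy : Type := Σ κ : SimpleTy, SizedTy κ

/-- Distribution types, of any underlying simple type. -/
abbrev AnyDistTy : Type := Σ κ : SimpleTy, DistTy κ

/-- Sized contexts over the variables in `Fin n`: a sized type for some of these variables. -/
abbrev Ctx (n : ℕ) : Type := Fin n → Option AnySizedTy

/-- Distribution contexts over the variables in `Fin n`: a distribution type for at most one of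
these variables. -/
abbrev DCtx (n : ℕ) : Type := Option (Fin n × AnyDistTy)

/-- The empty sized context. -/
def Ctx.empty {n : ℕ} : Ctx n := fun _ => none

/-- The empty distribution context. -/
def DCtx.empty {n : ℕ} : DCtx n := none

/-- `Γ`, below a binder whose variable is not in the domain. -/
def Ctx.weaken {n : ℕ} (Γ : Ctx n) : Ctx (n + 1) := Fin.cases none Γ

/-- `Γ, x : σ`, below the binder of `x`. -/
def Ctx.cons {n : ℕ} (Γ : Ctx n) {κ : SimpleTy} (σ : SizedTy κ) : Ctx (n + 1) :=
  Fin.cases (some ⟨κ, σ⟩) Γ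

/-- `Θ`, below a binder whose variable is not in the domain. -/
def DCtx.weaken {n : ℕ} (Θ : DCtx n) : DCtx (n + 1) :=
  Option.map (fun xμ => (xμ.1.succ, xμ.2)) Θ

/-- The domains of `Γ` and `Δ` are disjoint. -/
def Ctx.Disjoint {n : ℕ} (Γ Δ : Ctx n) : Prop := ∀ x, Γ x = none ∨ Δ x = none

/-- The union `Γ, Δ` of sized contexts (with disjoint domains). -/
def Ctx.union {n : ℕ} (Γ Δ : Ctx n) : Ctx n := fun x => (Γ x).or (Δ x)

/-- The domains of `Γ` and `Θ` are disjoint, so that `Γ | Θ` is a context. -/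
def Ctx.Apart {n : ℕ} (Γ : Ctx n) (Θ : DCtx n) : Prop := ∀ xμ ∈ Θ, Γ xμ.1 = none

/-- All types in `Γ` have the underlying simple type `Nat`. -/
def Ctx.IsNat {n : ℕ} (Γ : Ctx n) : Prop := ∀ x, ∀ t ∈ Γ x, t.1 = .nat

/-- The size variable `i` does not occur in `Γ`. -/
def Ctx.Fresh {n : ℕ} (i : ℕ) (Γ : Ctx n) : Prop := ∀ x, ∀ t ∈ Γ x, SizedTy.Fresh i t.2

/-- `Φ` is the union `Θ, Ψ`, which is defined when `Θ` or `Ψ` is empty. -/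
inductive DCtx.IsUnion {n : ℕ} : DCtx n → DCtx n → DCtx n → Prop where
  | left (Θ : DCtx n) : DCtx.IsUnion Θ none Θ
  | right (Ψ : DCtx n) : DCtx.IsUnion none Ψ Ψ

/-- `Φ` is the probabilistic sum `Θ ⊕_p Ψ`. -/
inductive DCtx.IsPSum {n : ℕ} (p : Set.Ioo (0 : ℝ≥0) 1) : DCtx n → DCtx n → DCtx n → Prop where
  | both (x : Fin n) {κ : SimpleTy} (μ ν : DistTy κ) :
      DCtx.IsPSum p (some (x, ⟨κ, μ⟩)) (some (x, ⟨κ, ν⟩)) (some (x, ⟨κ, μ.psum p ν⟩))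
  | left (x : Fin n) {κ : SimpleTy} (μ : DistTy κ) :
      DCtx.IsPSum p (some (x, ⟨κ, μ⟩)) none (some (x, ⟨κ, μ.scale p p.2.1 p.2.2.le⟩))
  | right (x : Fin n) {κ : SimpleTy} (μ : DistTy κ) :
      DCtx.IsPSum p none (some (x, ⟨κ, μ⟩))
        (some (x, ⟨κ, μ.scale (1 - (p : ℝ≥0)) (tsub_pos_of_lt p.2.2) tsub_le_self⟩))
  | empty : DCtx.IsPSum p none none none

/-- `Φ` is the weighted sum `∑ᵢ pᵢ · Ψᵢ`, where `μ = {xᵢ^{pᵢ} | i}` and `Ψᵢ = Ψ xᵢ`. -/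
inductive DCtx.IsWSum {n : ℕ} {X : Type} (μ : FinDist X) (Ψ : X → DCtx n) : DCtx n → Prop where
  | some (y : Fin n) {κ : SimpleTy} (ξ : X → DistTy κ) :
      (∀ x ∈ μ.w.support, Ψ x = Option.some (y, ⟨κ, ξ x⟩)) →
      DCtx.IsWSum μ Ψ (Option.some (y, ⟨κ, μ.bind ξ⟩))
  | empty : (∀ x ∈ μ.w.support, Ψ x = none) → DCtx.IsWSum μ Ψ none

/-! ## Typing -/

/-- The typing judgements `Γ | Θ ⊢ M : μ` of the monadic affine sized type system. A sized type
`σ` in the position of `μ` stands for the Dirac distribution type `{σ¹}`. -/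
inductive HasType :
    {n : ℕ} → Ctx n → DCtx n → Term n → {κ : SimpleTy} → DistTy κ → Prop where
  | var {n : ℕ} (Γ : Ctx n) (Θ : DCtx n) (x : Fin n) {κ : SimpleTy} (σ : SizedTy κ) :
      Γ.Apart Θ → Γ x = some ⟨κ, σ⟩ →
      HasType Γ Θ (.val (.var x)) (FinDist.pure σ)
  | var' {n : ℕ} (Γ : Ctx n) (x : Fin n) {κ : SimpleTy} (σ : SizedTy κ) :
      Γ.Apart (some (x, ⟨κ, FinDist.pure σ⟩)) →
      HasType Γ (some (x, ⟨κ, FinDist.pure σ⟩)) (.val (.var x)) (FinDist.pure σ)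
  | succ {n : ℕ} (Γ : Ctx n) (Θ : DCtx n) (V : Value n) (s : Size) :
      HasType Γ Θ (.val V) (FinDist.pure (SizedTy.nat s)) →
      HasType Γ Θ (.val (.succ V)) (FinDist.pure (SizedTy.nat s.succ))
  | zero {n : ℕ} (Γ : Ctx n) (Θ : DCtx n) (s : Size) :
      Γ.Apart Θ →
      HasType Γ Θ (.val .zero) (FinDist.pure (SizedTy.nat s.succ))
  | lam {n : ℕ} (Γ : Ctx n) (Θ : DCtx n) (M : Term (n + 1)) {κ κ' : SimpleTy}
      (σ : SizedTy κ) (μ : DistTy κ') :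
      HasType (Γ.cons σ) Θ.weaken M μ →
      HasType Γ Θ (.val (.lam M)) (FinDist.pure (SizedTy.arrow σ μ))
  | sub {n : ℕ} (Γ : Ctx n) (Θ : DCtx n) (M : Term n) {κ : SimpleTy} (μ ν : DistTy κ) :
      HasType Γ Θ M μ → DistTy.Sub μ ν →
      HasType Γ Θ M ν
  | app {n : ℕ} (Γ Δ Ξ : Ctx n) (Θ Ψ Φ : DCtx n) (V W : Value n) {κ κ' : SimpleTy}
      (σ : SizedTy κ) (μ : DistTy κ') :
      Γ.Disjoint Δ → Γ.Disjoint Ξ → Δ.Disjoint Ξ → Γ.IsNat →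
      DCtx.IsUnion Θ Ψ Φ → ((Γ.union Δ).union Ξ).Apart Φ →
      HasType (Γ.union Δ) Θ (.val V) (FinDist.pure (SizedTy.arrow σ μ)) →
      HasType (Γ.union Ξ) Ψ (.val W) (FinDist.pure σ) →
      HasType ((Γ.union Δ).union Ξ) Φ (.app V W) μ
  | choice {n : ℕ} (Γ : Ctx n) (Θ Ψ Φ : DCtx n) (p : Set.Ioo (0 : ℝ≥0) 1) (M N : Term n)
      {κ : SimpleTy} (μ ν : DistTy κ) :
      DCtx.IsPSum p Θ Ψ Φ →
      HasType Γ Θ M μ → HasType Γ Ψ N ν →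
      HasType Γ Φ (.choice p M N) (μ.psum p ν)
  | letin {n : ℕ} (Γ Δ Ξ : Ctx n) {κ κ' : SimpleTy} (Θ : DCtx n) (Ψ : SizedTy κ → DCtx n)
      (Ψ' Φ : DCtx n) (M : Term n) (N : Term (n + 1)) (μ : DistTy κ) (ν : SizedTy κ → DistTy κ') :
      Γ.Disjoint Δ → Γ.Disjoint Ξ → Δ.Disjoint Ξ → Γ.IsNat →
      DCtx.IsWSum μ Ψ Ψ' → DCtx.IsUnion Θ Ψ' Φ → ((Γ.union Δ).union Ξ).Apart Φ →
      HasType (Γ.union Δ) Θ M μ →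
      (∀ σ ∈ μ.w.support, HasType ((Γ.union Ξ).cons σ) (Ψ σ).weaken N (ν σ)) →
      HasType ((Γ.union Δ).union Ξ) Φ (.letin M N) (μ.bind ν)
  | case {n : ℕ} (Γ Δ : Ctx n) (Θ : DCtx n) (V W Z : Value n) (s : Size) {κ : SimpleTy}
      (μ : DistTy κ) :
      Γ.Disjoint Δ → (Γ.union Δ).Apart Θ →
      HasType Γ none (.val V) (FinDist.pure (SizedTy.nat s.succ)) →
      HasType Δ Θ (.val W) (FinDist.pure (SizedTy.arrow (SizedTy.nat s) μ)) →
      HasType Δ Θ (.val Z) μ →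
      HasType (Γ.union Δ) Θ (.case V W Z) μ
  | letrec {n : ℕ} (Γ Δ : Ctx n) (Θ : DCtx n) (V : Value (n + 1)) {κ : SimpleTy} (i : ℕ)
      (ν : DistTy κ) (μ : DistTy (.arr .nat κ)) (r : Size) :
      Γ.Disjoint Δ → (Γ.union Δ).Apart Θ → Γ.IsNat → Γ.Fresh i → DistTy.Pos i ν →
      (∀ σ ∈ μ.w.support, ∃ s : Size, s.spine = some i ∧
        σ = SizedTy.arrow (SizedTy.nat s) (DistTy.subst i s ν)) →
      WalkAST μ.inducedWalk →
      HasType Γ.weaken (some (0, ⟨_, μ⟩)) (.val V)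
        (FinDist.pure (SizedTy.arrow (SizedTy.nat (Size.var i 0).succ)
          (DistTy.subst i (Size.var i 0).succ ν))) →
      HasType (Γ.union Δ) Θ (.val (.letrec V))
        (FinDist.pure (SizedTy.arrow (SizedTy.nat r) (DistTy.subst i r ν)))

end

end MAST

/-!
Every closed value `V` and sized type `σ` receive a number `defect ρ σ V` in `[0, 1]`, the failure
of `V` to have the type `σ` when the size variables take the values `ρ`, and every closed term `M`
and distribution type `μ` receive a failure `err (defect ρ) μ M`. A value of type `Nat^s` either
fails completely or is a numeral below the value of `s`; the failure of a value of type `σ → μ` is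
the largest amount by which applying it adds to the failure of its argument. The failure of a term
is defined by duality: whenever a function `φ` of values and a function `b` of types satisfy
`1 - defect ρ σ V ≤ φ V + b σ`, the expected value `wp φ M` of `φ` at the result of `M`, plus the
integral of `b` against `μ`, is at least `1 - err (defect ρ) μ M`. With this definition failures
add up along `let` (`err_letin_le`), are averaged by `⊕_p` (`err_choice_le`) and decrease along
subtyping (`err_le_of_lift`), and no optimal coupling of values with types has to be chosen.

The typing rules then obey a union bound (`HasType.err_le`): a typable term fails at most as much
as the substituted values fail together, where the variable of a distribution context counts with
its average failure. Affinity makes every failure count once; the variables of type `Nat^s` may be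
shared because their failures are `0` or `1`. For `letrec` (`defect_letrec_eq_zero`) let `D m` be
the failure of the recursive function when its size variable has the value `m`. Then `D 0 = 0`, as
there is no argument below `0`, and `D (m + 1) ≤ ∑ⱼ pⱼ * D (m + kⱼ)` by the bound for the body, so
`D m` is at most the probability that the sized walk from `m` has not reached `0` after any given
number of steps (`WalkAST.eq_zero_of_le_integral`), hence `0`. Positivity extends this to the size
`∞`.

A closed typable term therefore has failure `0`, and `φ = 1`, `b = 0` give `1 ≤ wp 1 M`. As stuck
terms have pre-expectation `0`, none is reachable, all reductions of distributions can be carried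
out, and the semantics has sum `1` (`isAST_of_one_le_wp`).
-/

namespace MAST

noncomputable section

/-! ### Substitution -/

/-- The extension of the substitution `s` that sends the new variable `0` to `W`. -/
def extSub {n m : ℕ} (W : Value m) (s : Fin n → Value m) : Fin (n + 1) → Value m :=
  Fin.cases W s

theorem liftRen_liftRen {n m k : ℕ} (r : Fin n → Fin m) (r' : Fin m → Fin k) :
    (fun x => liftRen r' (liftRen r x)) = liftRen fun x => r' (r x) := by
  funext x
  cases x using Fin.cases <;> simp [liftRen]

theorem liftSub_liftRen {n m k : ℕ} (r : Fin n → Fin m) (s : Fin m → Value k) :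
    (fun x => liftSub s (liftRen r x)) = liftSub fun x => s (r x) := by
  funext x
  cases x using Fin.cases <;> simp [liftRen, liftSub]

mutual

theorem Term.rename_rename {n m k : ℕ} (r : Fin n → Fin m) (r' : Fin m → Fin k) :
    (M : Term n) → (M.rename r).rename r' = M.rename fun x => r' (r x)
  | .val V => by simp [Term.rename, Value.rename_rename r r' V]
  | .app V W => by
    simp [Term.rename, Value.rename_rename r r' V, Value.rename_rename r r' W]
  | .letin M N => by
    simp [Term.rename, Term.rename_rename r r' M, Term.rename_rename _ _ N, liftRen_liftRen]
  | .choice p M N => by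
    simp [Term.rename, Term.rename_rename r r' M, Term.rename_rename r r' N]
  | .case V W Z => by
    simp [Term.rename, Value.rename_rename r r' V, Value.rename_rename r r' W,
      Value.rename_rename r r' Z]

theorem Value.rename_rename {n m k : ℕ} (r : Fin n → Fin m) (r' : Fin m → Fin k) :
    (V : Value n) → (V.rename r).rename r' = V.rename fun x => r' (r x)
  | .var x => by simp [Value.rename]
  | .zero => by simp [Value.rename]
  | .succ V => by simp [Value.rename, Value.rename_rename r r' V]
  | .lam M => by simp [Value.rename, Term.rename_rename _ _ M, liftRen_liftRen]
  | .letrec V => by simp [Value.rename, Value.rename_rename _ _ V, liftRen_liftRen]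

end

mutual

theorem Term.subst_rename {n m k : ℕ} (r : Fin n → Fin m) (s : Fin m → Value k) :
    (M : Term n) → (M.rename r).subst s = M.subst fun x => s (r x)
  | .val V => by simp [Term.rename, Term.subst, Value.subst_rename r s V]
  | .app V W => by
    simp [Term.rename, Term.subst, Value.subst_rename r s V, Value.subst_rename r s W]
  | .letin M N => by
    simp [Term.rename, Term.subst, Term.subst_rename r s M, Term.subst_rename _ _ N,
      liftSub_liftRen]
  | .choice p M N => by
    simp [Term.rename, Term.subst, Term.subst_rename r s M, Term.subst_rename r s N]
  | .case V W Z => by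
    simp [Term.rename, Term.subst, Value.subst_rename r s V, Value.subst_rename r s W,
      Value.subst_rename r s Z]

theorem Value.subst_rename {n m k : ℕ} (r : Fin n → Fin m) (s : Fin m → Value k) :
    (V : Value n) → (V.rename r).subst s = V.subst fun x => s (r x)
  | .var x => by simp [Value.rename, Value.subst]
  | .zero => by simp [Value.rename, Value.subst]
  | .succ V => by simp [Value.rename, Value.subst, Value.subst_rename r s V]
  | .lam M => by simp [Value.rename, Value.subst, Term.subst_rename _ _ M, liftSub_liftRen]
  | .letrec V => by simp [Value.rename, Value.subst, Value.subst_rename _ _ V, liftSub_liftRen]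

end

theorem rename_liftSub {n m k : ℕ} (s : Fin n → Value m) (r : Fin m → Fin k) :
    (fun x => (liftSub s x).rename (liftRen r)) = liftSub fun x => (s x).rename r := by
  funext x
  cases x using Fin.cases <;> simp [liftRen, liftSub, Value.rename, Value.rename_rename]

mutual

theorem Term.rename_subst {n m k : ℕ} (s : Fin n → Value m) (r : Fin m → Fin k) :
    (M : Term n) → (M.subst s).rename r = M.subst fun x => (s x).rename r
  | .val V => by simp [Term.rename, Term.subst, Value.rename_subst s r V]
  | .app V W => by
    simp [Term.rename, Term.subst, Value.rename_subst s r V, Value.rename_subst s r W]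
  | .letin M N => by
    simp [Term.rename, Term.subst, Term.rename_subst s r M, Term.rename_subst _ _ N,
      rename_liftSub]
  | .choice p M N => by
    simp [Term.rename, Term.subst, Term.rename_subst s r M, Term.rename_subst s r N]
  | .case V W Z => by
    simp [Term.rename, Term.subst, Value.rename_subst s r V, Value.rename_subst s r W,
      Value.rename_subst s r Z]

theorem Value.rename_subst {n m k : ℕ} (s : Fin n → Value m) (r : Fin m → Fin k) :
    (V : Value n) → (V.subst s).rename r = V.subst fun x => (s x).rename r
  | .var x => by simp [Value.subst]
  | .zero => by simp [Value.rename, Value.subst]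
  | .succ V => by simp [Value.rename, Value.subst, Value.rename_subst s r V]
  | .lam M => by simp [Value.rename, Value.subst, Term.rename_subst _ _ M, rename_liftSub]
  | .letrec V => by simp [Value.rename, Value.subst, Value.rename_subst _ _ V, rename_liftSub]

end

theorem subst_liftSub {n m k : ℕ} (s : Fin n → Value m) (t : Fin m → Value k) :
    (fun x => (liftSub s x).subst (liftSub t)) = liftSub fun x => (s x).subst t := by
  funext x
  cases x using Fin.cases <;>
    simp [liftSub, Value.subst, Value.subst_rename, Value.rename_subst]

mutual

theorem Term.subst_subst {n m k : ℕ} (s : Fin n → Value m) (t : Fin m → Value k) :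
    (M : Term n) → (M.subst s).subst t = M.subst fun x => (s x).subst t
  | .val V => by simp [Term.subst, Value.subst_subst s t V]
  | .app V W => by simp [Term.subst, Value.subst_subst s t V, Value.subst_subst s t W]
  | .letin M N => by
    simp [Term.subst, Term.subst_subst s t M, Term.subst_subst _ _ N, subst_liftSub]
  | .choice p M N => by simp [Term.subst, Term.subst_subst s t M, Term.subst_subst s t N]
  | .case V W Z => by
    simp [Term.subst, Value.subst_subst s t V, Value.subst_subst s t W, Value.subst_subst s t Z]

theorem Value.subst_subst {n m k : ℕ} (s : Fin n → Value m) (t : Fin m → Value k) :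
    (V : Value n) → (V.subst s).subst t = V.subst fun x => (s x).subst t
  | .var x => by simp [Value.subst]
  | .zero => by simp [Value.subst]
  | .succ V => by simp [Value.subst, Value.subst_subst s t V]
  | .lam M => by simp [Value.subst, Term.subst_subst _ _ M, subst_liftSub]
  | .letrec V => by simp [Value.subst, Value.subst_subst _ _ V, subst_liftSub]

end

theorem liftSub_var {n : ℕ} : liftSub (Value.var : Fin n → Value n) = Value.var := by
  funext x
  cases x using Fin.cases <;> simp [liftSub, Value.rename]

mutual

theorem Term.subst_var {n : ℕ} : (M : Term n) → M.subst Value.var = M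
  | .val V => by simp [Term.subst, Value.subst_var V]
  | .app V W => by simp [Term.subst, Value.subst_var V, Value.subst_var W]
  | .letin M N => by simp [Term.subst, Term.subst_var M, Term.subst_var N, liftSub_var]
  | .choice p M N => by simp [Term.subst, Term.subst_var M, Term.subst_var N]
  | .case V W Z => by simp [Term.subst, Value.subst_var V, Value.subst_var W, Value.subst_var Z]

theorem Value.subst_var {n : ℕ} : (V : Value n) → V.subst Value.var = V
  | .var x => by simp [Value.subst]
  | .zero => by simp [Value.subst]
  | .succ V => by simp [Value.subst, Value.subst_var V]
  | .lam M => by simp [Value.subst, Term.subst_var M, liftSub_var]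
  | .letrec V => by simp [Value.subst, Value.subst_var V, liftSub_var]

end

theorem subst_single_liftSub {n m : ℕ} (s : Fin n → Value m) (W : Value m) :
    (fun x => (liftSub s x).subst (single W)) = extSub W s := by
  funext x
  cases x using Fin.cases with
  | zero => simp [liftSub, single, extSub, Value.subst]
  | succ x =>
    simp only [liftSub, extSub, Fin.cases_succ, Value.subst_rename]
    exact Value.subst_var (s x)

theorem Term.inst_subst_liftSub {n m : ℕ} (M : Term (n + 1)) (s : Fin n → Value m)
    (W : Value m) : (M.subst (liftSub s)).inst W = M.subst (extSub W s) := by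
  rw [Term.inst, Term.subst_subst, subst_single_liftSub]

theorem Value.inst_subst_liftSub {n m : ℕ} (V : Value (n + 1)) (s : Fin n → Value m)
    (W : Value m) : (V.subst (liftSub s)).inst W = V.subst (extSub W s) := by
  rw [Value.inst, Value.subst_subst, subst_single_liftSub]

/-! ### The one-step kernel -/

theorem Step.not_isValue {n : ℕ} {M : Term n} {E : Term n → ℝ≥0∞} (h : Step M E) :
    ¬ M.IsValue := by
  rintro ⟨V, rfl⟩
  cases h

theorem Step.unique {n : ℕ} {M : Term n} {E E' : Term n → ℝ≥0∞} (h : Step M E)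
    (h' : Step M E') : E = E' := by
  induction h generalizing E' with
  | let_value V M =>
    cases h' with
    | let_value => rfl
    | let_step _ _ _ h => exact absurd ⟨V, rfl⟩ h.not_isValue
  | let_step M N E h ih =>
    cases h' with
    | let_value => exact absurd ⟨_, rfl⟩ h.not_isValue
    | let_step _ _ _ h2 => rw [ih h2]
  | beta | choice | case_succ | case_zero | unfold => cases h'; rfl

theorem tsum_dirac_mul {X : Type} (x : X) (u : X → ℝ≥0∞) : ∑' y, dirac x y * u y = u x := by
  rw [tsum_eq_single x]
  · simp [dirac]
  · intro y hy
    simp [dirac, hy]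

theorem tsum_pushforward_mul {X Y : Type} (f : X → Y) (D : X → ℝ≥0∞) (u : Y → ℝ≥0∞) :
    ∑' y, pushforward f D y * u y = ∑' x, D x * u (f x) := by
  simp only [pushforward, ← ENNReal.tsum_mul_right]
  rw [ENNReal.tsum_comm]
  refine tsum_congr fun x => ?_
  rw [tsum_eq_single (f x)]
  · simp
  · intro y hy
    simp [hy.symm]

theorem tsum_choice_mul {X : Type} (p : Set.Ioo (0 : ℝ≥0) 1) (x y : X) (u : X → ℝ≥0∞) :
    ∑' z, (((p : ℝ≥0) : ℝ≥0∞) • dirac x + ((1 - (p : ℝ≥0) : ℝ≥0) : ℝ≥0∞) • dirac y) z * u z =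
      ((p : ℝ≥0) : ℝ≥0∞) * u x + ((1 - (p : ℝ≥0) : ℝ≥0) : ℝ≥0∞) * u y := by
  simp only [Pi.add_apply, Pi.smul_apply, smul_eq_mul, add_mul, mul_assoc]
  rw [ENNReal.tsum_add, ENNReal.tsum_mul_left, ENNReal.tsum_mul_left, tsum_dirac_mul,
    tsum_dirac_mul]

theorem coe_add_coe_one_sub (p : Set.Ioo (0 : ℝ≥0) 1) :
    ((p : ℝ≥0) : ℝ≥0∞) + ((1 - (p : ℝ≥0) : ℝ≥0) : ℝ≥0∞) = 1 := by
  rw [← ENNReal.coe_add, add_tsub_cancel_of_le p.2.2.le, ENNReal.coe_one]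

theorem Step.distrSum_eq {n : ℕ} {M : Term n} {E : Term n → ℝ≥0∞} (h : Step M E) :
    distrSum E = 1 := by
  have key (E : Term n → ℝ≥0∞) : distrSum E = ∑' L, E L * (fun _ => 1) L := by simp [distrSum]
  induction h with
  | choice p M N =>
    rw [key, tsum_choice_mul]
    simpa using coe_add_coe_one_sub p
  | let_step M N E h ih =>
    rw [key, tsum_pushforward_mul]
    simpa [distrSum] using ih
  | _ => rw [key, tsum_dirac_mul]

open Classical in
/-- One step of reduction as a kernel: a value stays where it is, and a stuck term, which is
neither a value nor reducible, loses all of its mass. -/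
def stepKernel {n : ℕ} (M : Term n) : Term n → ℝ≥0∞ :=
  if M.IsValue then dirac M else if h : ∃ E, Step M E then h.choose else 0

theorem stepKernel_val {n : ℕ} (V : Value n) : stepKernel (.val V) = dirac (.val V) :=
  if_pos ⟨V, rfl⟩

theorem Step.stepKernel_eq {n : ℕ} {M : Term n} {E : Term n → ℝ≥0∞} (h : Step M E) :
    stepKernel M = E := by
  have hE : ∃ E, Step M E := ⟨E, h⟩
  rw [stepKernel, if_neg h.not_isValue, dif_pos hE]
  exact hE.choose_spec.unique h

theorem tsum_stepKernel_le {n : ℕ} (M : Term n) : ∑' L, stepKernel M L ≤ 1 := by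
  by_cases hM : M.IsValue
  · obtain ⟨V, rfl⟩ := hM
    have h := tsum_dirac_mul (Term.val V) (fun _ => 1)
    simp only [mul_one] at h
    rw [stepKernel_val, h]
  · by_cases h : ∃ E, Step M E
    · obtain ⟨E, h⟩ := h
      rw [h.stepKernel_eq]
      exact h.distrSum_eq.le
    · simp [stepKernel, hM, h]

/-- The action of the one-step kernel on distributions. -/
def stepDistr {n : ℕ} (D : Term n → ℝ≥0∞) : Term n → ℝ≥0∞ :=
  fun L => ∑' M, D M * stepKernel M L

theorem tsum_stepDistr_mul {n : ℕ} (D u : Term n → ℝ≥0∞) :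
    ∑' L, stepDistr D L * u L = ∑' M, D M * ∑' L, stepKernel M L * u L := by
  simp only [stepDistr, ← ENNReal.tsum_mul_right, ← ENNReal.tsum_mul_left]
  rw [ENNReal.tsum_comm]
  simp only [mul_assoc]

theorem stepDistr_eq_add {n : ℕ} (D : Term n → ℝ≥0∞) (L : Term n) :
    stepDistr D L = (∑' M, termPart D M * stepKernel M L) + valuePart D L := by
  have h : valuePart D L = ∑' M, valuePart D M * stepKernel M L := by
    have h2 (M : Term n) : valuePart D M * stepKernel M L = dirac L M * valuePart D M := by
      by_cases hM : M.IsValue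
      · by_cases h : L = M
        · simp [valuePart, stepKernel, hM, dirac, h]
        · simp [valuePart, stepKernel, hM, dirac, h, Ne.symm h]
      · simp [valuePart, hM]
    rw [tsum_congr h2, tsum_dirac_mul]
  rw [h, ← ENNReal.tsum_add]
  refine tsum_congr fun M => ?_
  rw [← add_mul]
  by_cases hM : M.IsValue <;> simp [termPart, valuePart, hM]

theorem DistStep.eq_stepDistr {n : ℕ} {D E : Term n → ℝ≥0∞} (h : DistStep D E) :
    E = stepDistr D := by
  obtain ⟨F, hF, rfl⟩ := h
  funext L
  rw [stepDistr_eq_add]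
  congr 1
  refine tsum_congr fun M => ?_
  by_cases hM : termPart D M = 0
  · simp [hM]
  · rw [(hF M hM).stepKernel_eq]

theorem distStep_stepDistr {n : ℕ} {D : Term n → ℝ≥0∞}
    (h : ∀ M, termPart D M ≠ 0 → ∃ E, Step M E) : DistStep D (stepDistr D) := by
  refine ⟨stepKernel, fun M hM => ?_, funext (stepDistr_eq_add D)⟩
  obtain ⟨E, hE⟩ := h M hM
  rwa [hE.stepKernel_eq]

theorem DistSteps.eq_iterate {n k : ℕ} {D E : Term n → ℝ≥0∞} (h : DistSteps k D E) :
    E = stepDistr^[k] D := by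
  induction k generalizing D with
  | zero => exact h
  | succ k ih =>
    obtain ⟨D', h1, h2⟩ := h
    rw [ih h2, h1.eq_stepDistr, Function.iterate_succ_apply]

theorem valuePart_le_stepDistr {n : ℕ} (D : Term n → ℝ≥0∞) :
    valuePart D ≤ valuePart (stepDistr D) := by
  intro M
  refine Set.indicator_le_indicator' (fun hM => ?_)
  rw [stepDistr_eq_add]
  refine le_add_left ?_
  rw [valuePart, Set.indicator_of_mem hM]

theorem tsum_iSup_of_monotone {X : Type} {f : X → ℕ → ℝ≥0∞} (hf : ∀ x, Monotone (f x)) :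
    ∑' x, ⨆ n, f x n = ⨆ n, ∑' x, f x n := by
  simp only [ENNReal.tsum_eq_iSup_sum]
  rw [iSup_comm]
  exact iSup_congr fun s => ENNReal.finsetSum_iSup_of_monotone fun x => hf x

theorem monotone_valuePart_iterate {n : ℕ} (D : Term n → ℝ≥0∞) :
    Monotone fun k => valuePart (stepDistr^[k] D) := by
  refine monotone_nat_of_le_succ fun k => ?_
  rw [Function.iterate_succ_apply']
  exact valuePart_le_stepDistr _

theorem tsum_iterate_stepDistr_le {n : ℕ} {D : Term n → ℝ≥0∞} (hD : ∑' M, D M ≤ 1) (k : ℕ) :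
    ∑' M, (stepDistr^[k] D) M ≤ 1 := by
  induction k generalizing D with
  | zero => exact hD
  | succ k ih =>
    rw [Function.iterate_succ_apply]
    refine ih ?_
    have h := tsum_stepDistr_mul D fun _ => 1
    simp only [mul_one] at h
    rw [h]
    exact le_trans (ENNReal.tsum_le_tsum fun M => mul_le_of_le_one_right' (tsum_stepKernel_le M)) hD

theorem distrSum_semantics_le_one {n : ℕ} (M : Term n) :
    distrSum (semantics (dirac M)) ≤ 1 := by
  have hD : ∑' L, dirac M L ≤ 1 := by
    have h := tsum_dirac_mul M fun _ => 1
    simp only [mul_one] at h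
    exact h.le
  have h : semantics (dirac M) ≤ fun L => ⨆ k, valuePart (stepDistr^[k] (dirac M)) L := by
    refine sSup_le ?_
    rintro _ ⟨k, E, hE, rfl⟩ L
    rw [hE.eq_iterate]
    exact le_iSup (fun k => valuePart (stepDistr^[k] (dirac M)) L) k
  refine le_trans (ENNReal.tsum_le_tsum h) ?_
  rw [tsum_iSup_of_monotone fun L i j hij => monotone_valuePart_iterate _ hij L]
  refine iSup_le fun k => le_trans (ENNReal.tsum_le_tsum fun L => ?_)
    (tsum_iterate_stepDistr_le hD k)
  exact Set.indicator_le_self' (fun _ _ => zero_le) L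

/-! ### Weakest pre-expectations -/

/-- The functions `u` on terms that dominate `φ` on values and do not increase on average along
reduction. -/
def PreExp {n : ℕ} (φ : Value n → ℝ≥0∞) (u : Term n → ℝ≥0∞) : Prop :=
  (∀ V, φ V ≤ u (.val V)) ∧ ∀ M E, Step M E → ∑' L, E L * u L ≤ u M

/-- The expectation of `φ` at the value reached by a term, diverging and stuck runs counting as
`0`, as a least pre-fixed point. -/
def wp {n : ℕ} (φ : Value n → ℝ≥0∞) (M : Term n) : ℝ≥0∞ :=
  ⨅ (u : Term n → ℝ≥0∞) (_ : PreExp φ u), u M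

theorem wp_le {n : ℕ} {φ : Value n → ℝ≥0∞} {u : Term n → ℝ≥0∞} (h : PreExp φ u) (M : Term n) :
    wp φ M ≤ u M :=
  iInf₂_le u h

theorem preExp_wp {n : ℕ} (φ : Value n → ℝ≥0∞) : PreExp φ (wp φ) := by
  refine ⟨fun V => le_iInf₂ fun u hu => hu.1 V, fun M E h => le_iInf₂ fun u hu => ?_⟩
  refine le_trans (ENNReal.tsum_le_tsum fun L => ?_) (hu.2 M E h)
  gcongr
  exact wp_le hu L

theorem Step.le_wp {n : ℕ} {M : Term n} {E : Term n → ℝ≥0∞} (h : Step M E)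
    (φ : Value n → ℝ≥0∞) : ∑' L, E L * wp φ L ≤ wp φ M :=
  (preExp_wp φ).2 M E h

theorem Step.wp_le_of_dirac {n : ℕ} {M L : Term n} (h : Step M (dirac L))
    (φ : Value n → ℝ≥0∞) : wp φ L ≤ wp φ M := by
  have h2 := h.le_wp φ
  rwa [tsum_dirac_mul] at h2

theorem wp_val {n : ℕ} (φ : Value n → ℝ≥0∞) (V : Value n) : wp φ (.val V) = φ V := by
  refine le_antisymm ?_ ((preExp_wp φ).1 V)
  -- Values do not reduce, so `⊤` on all other terms satisfies the condition on steps.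
  let u : Term n → ℝ≥0∞ := fun M => match M with
    | .val V => φ V
    | _ => ⊤
  refine wp_le (u := u) ⟨fun V => le_rfl, fun M E h => ?_⟩ (.val V)
  have hM := h.not_isValue
  cases M with
  | val V => exact absurd ⟨V, rfl⟩ hM
  | _ => exact le_top

theorem wp_letin_le {n : ℕ} (φ : Value n → ℝ≥0∞) (M : Term n) (N : Term (n + 1)) :
    wp (fun V => wp φ (N.inst V)) M ≤ wp φ (.letin M N) := by
  refine wp_le (u := fun M => wp φ (.letin M N)) ⟨fun V => ?_, fun M E h => ?_⟩ M
  · exact (Step.let_value V N).wp_le_of_dirac φ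
  · have h2 := (Step.let_step M N E h).le_wp φ
    rwa [tsum_pushforward_mul] at h2

theorem le_wp_choice {n : ℕ} (φ : Value n → ℝ≥0∞) (p : Set.Ioo (0 : ℝ≥0) 1) (M N : Term n) :
    ((p : ℝ≥0) : ℝ≥0∞) * wp φ M + ((1 - (p : ℝ≥0) : ℝ≥0) : ℝ≥0∞) * wp φ N ≤
      wp φ (.choice p M N) := by
  have h := (Step.choice p M N).le_wp φ
  rwa [tsum_choice_mul] at h

/-! ### Adequacy -/

open Classical in
/-- The probability that `M` reaches a value in at most `k` steps. -/
def valueProb {n : ℕ} : ℕ → Term n → ℝ≥0∞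
  | 0, M => if M.IsValue then 1 else 0
  | k + 1, M => ∑' L, stepKernel M L * valueProb k L

theorem valueProb_val {n : ℕ} (k : ℕ) (V : Value n) : valueProb k (.val V) = 1 := by
  induction k with
  | zero => exact if_pos ⟨V, rfl⟩
  | succ k ih => rw [valueProb, stepKernel_val, tsum_dirac_mul, ih]

theorem valueProb_le_succ {n : ℕ} (k : ℕ) (M : Term n) : valueProb k M ≤ valueProb (k + 1) M := by
  induction k generalizing M with
  | zero =>
    by_cases hM : M.IsValue
    · obtain ⟨V, rfl⟩ := hM
      rw [valueProb_val, valueProb_val]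
    · simp [valueProb, hM]
  | succ k ih =>
    exact ENNReal.tsum_le_tsum fun L => mul_le_mul_right (ih L) _

theorem monotone_valueProb {n : ℕ} (M : Term n) : Monotone fun k => valueProb k M :=
  monotone_nat_of_le_succ fun k => valueProb_le_succ k M

theorem valueProb_le_one {n : ℕ} (k : ℕ) (M : Term n) : valueProb k M ≤ 1 := by
  induction k generalizing M with
  | zero => unfold valueProb; split_ifs <;> simp
  | succ k ih =>
    exact le_trans (ENNReal.tsum_le_tsum fun L => mul_le_of_le_one_right' (ih L))
      (tsum_stepKernel_le M)

theorem tsum_stepKernel_mul_iSup {n : ℕ} (M : Term n) :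
    ∑' L, stepKernel M L * ⨆ k, valueProb k L = ⨆ k, valueProb k M := by
  simp only [ENNReal.mul_iSup]
  rw [tsum_iSup_of_monotone (f := fun L k => stepKernel M L * valueProb k L)
    fun L i j hij => mul_le_mul_right (monotone_valueProb L hij) _]
  exact (monotone_valueProb M).iSup_nat_add 1

theorem wp_one_le {n : ℕ} (M : Term n) : wp (fun _ => 1) M ≤ ⨆ k, valueProb k M := by
  refine wp_le (u := fun M => ⨆ k, valueProb k M) ⟨fun V => ?_, fun M E h => ?_⟩ M
  · simp [valueProb_val]
  · rw [← h.stepKernel_eq, tsum_stepKernel_mul_iSup]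

/-- Terms that reach a value with probability `1` are closed under reduction, because the mass
lost by a successor is lost by the term itself. -/
theorem one_le_iSup_valueProb_of_stepKernel {n : ℕ} {M L : Term n}
    (hM : 1 ≤ ⨆ k, valueProb k M) (hL : stepKernel M L ≠ 0) : 1 ≤ ⨆ k, valueProb k L := by
  by_contra! h
  have h1 : ∑' L, stepKernel M L ≠ ⊤ := ne_top_of_le_ne_top ENNReal.one_ne_top
    (tsum_stepKernel_le M)
  have h2 (L : Term n) : stepKernel M L * ⨆ k, valueProb k L ≤ stepKernel M L :=
    mul_le_of_le_one_right' (iSup_le fun k => valueProb_le_one k L)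
  have h3 : stepKernel M L * ⨆ k, valueProb k L < stepKernel M L := by
    have h4 := ENNReal.mul_lt_mul_right hL (ne_top_of_le_ne_top h1 (ENNReal.le_tsum L)) h
    rwa [mul_one] at h4
  have h4 := ENNReal.tsum_lt_tsum (ne_top_of_le_ne_top h1 (ENNReal.tsum_le_tsum h2)) h2 h3
  rw [tsum_stepKernel_mul_iSup] at h4
  exact absurd (hM.trans_lt h4) (tsum_stepKernel_le M).not_gt

theorem exists_step_of_one_le_iSup_valueProb {n : ℕ} {M : Term n}
    (hM : 1 ≤ ⨆ k, valueProb k M) (hv : ¬ M.IsValue) : ∃ E, Step M E := by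
  by_contra h
  rw [← tsum_stepKernel_mul_iSup] at hM
  simp [stepKernel, hv, h] at hM

theorem distSteps_iterate {n : ℕ} {D : Term n → ℝ≥0∞}
    (hD : ∀ M, D M ≠ 0 → 1 ≤ ⨆ k, valueProb k M) (k : ℕ) : DistSteps k D (stepDistr^[k] D) := by
  induction k generalizing D with
  | zero => rfl
  | succ k ih =>
    refine ⟨stepDistr D, distStep_stepDistr fun M hM => ?_, ?_⟩
    · by_cases hv : M.IsValue
      · simp [termPart, hv] at hM
      · refine exists_step_of_one_le_iSup_valueProb (hD M ?_) hv
        simpa [termPart, hv] using hM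
    · refine ih fun L hL => ?_
      obtain ⟨M, hM⟩ : ∃ M, D M * stepKernel M L ≠ 0 := by
        by_contra! h
        exact hL (by simp [stepDistr, h])
      exact one_le_iSup_valueProb_of_stepKernel (hD M (left_ne_zero_of_mul hM))
        (right_ne_zero_of_mul hM)

theorem distrSum_valuePart_iterate {n : ℕ} (D : Term n → ℝ≥0∞) (k : ℕ) :
    distrSum (valuePart (stepDistr^[k] D)) = ∑' M, D M * valueProb k M := by
  induction k generalizing D with
  | zero =>
    refine tsum_congr fun M => ?_
    by_cases hM : M.IsValue <;> simp [valuePart, valueProb, hM]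
  | succ k ih =>
    rw [Function.iterate_succ_apply, ih, tsum_stepDistr_mul]
    rfl

/-- A term whose weakest pre-expectation of `1` is full never meets a stuck term, so that its
semantics collects the whole mass of the values it reaches. -/
theorem isAST_of_one_le_wp {n : ℕ} {M : Term n} (hM : 1 ≤ wp (fun _ => 1) M) : M.IsAST := by
  have h := hM.trans (wp_one_le M)
  refine le_antisymm (distrSum_semantics_le_one M) (h.trans (iSup_le fun k => ?_))
  have h2 : valueProb k M = distrSum (valuePart (stepDistr^[k] (dirac M))) := by
    rw [distrSum_valuePart_iterate, tsum_dirac_mul]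
  rw [h2]
  suffices h3 : valuePart (stepDistr^[k] (dirac M)) ≤ semantics (dirac M) from
    ENNReal.tsum_le_tsum h3
  refine le_sSup ⟨k, _, distSteps_iterate (fun L hL => ?_) k, rfl⟩
  have hL : L = M := by
    by_contra hne
    exact hL (if_neg hne)
  rwa [hL]

/-! ### Integration against finite distributions -/

namespace FinDist

variable {X Y : Type}

/-- The integral `∑ᵢ pᵢ · b xᵢ` of `b` against `μ = {xᵢ^{pᵢ} | i}`. -/
def integral (μ : FinDist X) (b : X → ℝ≥0∞) : ℝ≥0∞ :=
  μ.w.sum fun x a => (a : ℝ≥0∞) * b x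

theorem sum_smul_mul (p : ℝ≥0) (f : X →₀ ℝ≥0) (b : X → ℝ≥0∞) :
    ((p • f).sum fun x a => (a : ℝ≥0∞) * b x) = p * f.sum fun x a => (a : ℝ≥0∞) * b x := by
  rw [Finsupp.sum_smul_index' (fun _ => by simp), Finsupp.mul_sum]
  simp [mul_assoc]

theorem sum_add_mul (f g : X →₀ ℝ≥0) (b : X → ℝ≥0∞) :
    ((f + g).sum fun x a => (a : ℝ≥0∞) * b x) =
      (f.sum fun x a => (a : ℝ≥0∞) * b x) + g.sum fun x a => (a : ℝ≥0∞) * b x :=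
  Finsupp.sum_add_index' (fun _ => by simp) (fun _ _ _ => by simp [add_mul])

theorem integral_pure (x : X) (b : X → ℝ≥0∞) : (pure x).integral b = b x := by
  have h := Finsupp.sum_single_index (a := x) (b := (1 : ℝ≥0))
    (h := fun x a => (a : ℝ≥0∞) * b x) (by simp)
  exact h.trans (by rw [ENNReal.coe_one, one_mul])

theorem integral_scale (p : ℝ≥0) (h0 : 0 < p) (h1 : p ≤ 1) (μ : FinDist X) (b : X → ℝ≥0∞) :
    (μ.scale p h0 h1).integral b = p * μ.integral b :=
  sum_smul_mul p μ.w b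

theorem integral_psum (p : Set.Ioo (0 : ℝ≥0) 1) (μ ν : FinDist X) (b : X → ℝ≥0∞) :
    (μ.psum p ν).integral b = ((p : ℝ≥0) : ℝ≥0∞) * μ.integral b +
      ((1 - (p : ℝ≥0) : ℝ≥0) : ℝ≥0∞) * ν.integral b := by
  refine (sum_add_mul _ _ b).trans ?_
  rw [sum_smul_mul, sum_smul_mul]
  rfl

theorem integral_map (f : X → Y) (μ : FinDist X) (b : Y → ℝ≥0∞) :
    (μ.map f).integral b = μ.integral fun x => b (f x) :=
  Finsupp.sum_mapDomain_index (fun _ => by simp) (fun _ _ _ => by simp [add_mul])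

theorem integral_bind (μ : FinDist X) (ν : X → FinDist Y) (b : Y → ℝ≥0∞) :
    (μ.bind ν).integral b = μ.integral fun x => (ν x).integral b := by
  refine (Finsupp.sum_sum_index (f := μ.w) (g := fun x a => a • (ν x).w)
    (h := fun y a => (a : ℝ≥0∞) * b y) (fun _ => by simp)
    (fun _ _ _ => by simp [add_mul])).trans ?_
  exact Finset.sum_congr rfl fun x _ => sum_smul_mul _ _ b

theorem integral_add (μ : FinDist X) (b b' : X → ℝ≥0∞) :
    (μ.integral fun x => b x + b' x) = μ.integral b + μ.integral b' := by
  simp [integral, Finsupp.sum, mul_add, Finset.sum_add_distrib]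

theorem integral_mono {μ : FinDist X} {b b' : X → ℝ≥0∞} (h : ∀ x ∈ μ.w.support, b x ≤ b' x) :
    μ.integral b ≤ μ.integral b' :=
  Finset.sum_le_sum fun x hx => mul_le_mul_right (h x hx) _

theorem integral_const_le (μ : FinDist X) (c : ℝ≥0∞) : (μ.integral fun _ => c) ≤ c := by
  rw [integral, Finsupp.sum, ← Finset.sum_mul]
  refine mul_le_of_le_one_left' ?_
  exact_mod_cast μ.sum_le_one

theorem integral_zero (μ : FinDist X) : (μ.integral fun _ => 0) = 0 :=
  le_antisymm (μ.integral_const_le 0) zero_le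

theorem mem_support_psum (p : Set.Ioo (0 : ℝ≥0) 1) (μ ν : FinDist X) (x : X) :
    x ∈ (μ.psum p ν).w.support ↔ x ∈ μ.w.support ∨ x ∈ ν.w.support := by
  have h1 : (1 - (p : ℝ≥0)) ≠ 0 := (tsub_pos_of_lt p.2.2).ne'
  have h0 : (p : ℝ≥0) ≠ 0 := p.2.1.ne'
  have h : (μ.psum p ν).w x = (p : ℝ≥0) * μ.w x + (1 - (p : ℝ≥0)) * ν.w x := rfl
  simp only [Finsupp.mem_support_iff, h, ne_eq, add_eq_zero, mul_eq_zero, h0, h1, false_or]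
  tauto

theorem mem_support_map (f : X → Y) (μ : FinDist X) (y : Y) :
    y ∈ (μ.map f).w.support ↔ ∃ x ∈ μ.w.support, f x = y := by
  classical
  have h : (μ.map f).w = μ.w.mapDomain f := rfl
  rw [h]
  constructor
  · intro hy
    simpa using Finsupp.mapDomain_support hy
  · rintro ⟨x, hx, rfl⟩
    rw [Finsupp.mem_support_iff]
    intro h0
    have h2 : ((μ.w.mapDomain f).sum fun z a => (a : ℝ≥0∞) * if z = f x then 1 else 0) = 0 := by
      refine Finset.sum_eq_zero fun z _ => ?_
      by_cases hz : z = f x <;> simp [hz, h0]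
    rw [Finsupp.sum_mapDomain_index (fun _ => by simp)
      (fun _ _ _ => by rw [ENNReal.coe_add, add_mul])] at h2
    have h3 := Finset.sum_eq_zero_iff.mp h2 x hx
    simp at h3
    exact Finsupp.mem_support_iff.mp hx h3

theorem mem_support_bind {μ : FinDist X} {ν : X → FinDist Y} {x : X} {y : Y}
    (hx : x ∈ μ.w.support) (hy : y ∈ (ν x).w.support) : y ∈ (μ.bind ν).w.support := by
  have h : (μ.bind ν).w y = ∑ x ∈ μ.w.support, μ.w x * (ν x).w y := by
    have h : (μ.bind ν).w = ∑ x ∈ μ.w.support, μ.w x • (ν x).w := rfl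
    rw [h]
    simp
  rw [Finsupp.mem_support_iff, h]
  intro h0
  have h1 := Finset.sum_eq_zero_iff.mp h0 x hx
  exact mul_ne_zero (Finsupp.mem_support_iff.mp hx) (Finsupp.mem_support_iff.mp hy) h1

/-- The lifting of a relation makes integrals comparable along its map of supports. -/
theorem integral_comp_le {μ ν : FinDist X} {f : X → X}
    (hf : ∀ x ∈ μ.w.support, f x ∈ ν.w.support)
    (h : ∀ y ∈ ν.w.support, (μ.map f).w y ≤ ν.w y) (b : X → ℝ≥0∞) :
    (μ.integral fun x => b (f x)) ≤ ν.integral b := by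
  rw [← integral_map]
  have hs : (μ.map f).w.support ⊆ ν.w.support := by
    intro y hy
    obtain ⟨x, hx, rfl⟩ := (mem_support_map f μ y).mp hy
    exact hf x hx
  refine le_trans (Finset.sum_le_sum fun y hy => ?_) (Finset.sum_le_sum_of_subset hs)
  exact mul_le_mul_left (ENNReal.coe_le_coe.mpr (h y (hs hy))) _

end FinDist

/-! ### Errors and defects -/

section Err

variable {X Y : Type}

/-- For every type `x` of the support of `μ`, the success `1 - d x V` of any value `V` at `x` is
covered by `φ V` and `b x`. -/
def Admissible (d : X → Value 0 → ℝ≥0∞) (μ : FinDist X) (φ : Value 0 → ℝ≥0∞)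
    (b : X → ℝ≥0∞) : Prop :=
  ∀ x ∈ μ.w.support, ∀ V, 1 ≤ d x V + (φ V + b x)

/-- The failure of a term to have the distribution type `μ`, where `d x V` is the failure of the
value `V` to have the type `x`. The admissible pairs are the feasible points of the dual of a
transport problem, which matches the values reached by `M` with the types of `μ` so as to maximize
the total success; the failure is `1` minus the value of this dual. -/
def err (d : X → Value 0 → ℝ≥0∞) (μ : FinDist X) (M : Term 0) : ℝ≥0∞ :=
  ⨆ (φ : Value 0 → ℝ≥0∞) (b : X → ℝ≥0∞) (_ : Admissible d μ φ b), 1 - (wp φ M + μ.integral b)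

theorem err_le_iff {d : X → Value 0 → ℝ≥0∞} {μ : FinDist X} {M : Term 0} {a : ℝ≥0∞} :
    err d μ M ≤ a ↔ ∀ φ b, Admissible d μ φ b → 1 ≤ a + (wp φ M + μ.integral b) := by
  simp only [err, iSup_le_iff, tsub_le_iff_right]

theorem one_le_err_add {d : X → Value 0 → ℝ≥0∞} {μ : FinDist X} {φ : Value 0 → ℝ≥0∞}
    {b : X → ℝ≥0∞} (h : Admissible d μ φ b) (M : Term 0) :
    1 ≤ err d μ M + (wp φ M + μ.integral b) :=
  err_le_iff.mp le_rfl φ b h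

theorem err_le_one (d : X → Value 0 → ℝ≥0∞) (μ : FinDist X) (M : Term 0) : err d μ M ≤ 1 :=
  err_le_iff.mpr fun _ _ _ => le_self_add

theorem err_le_of_wp_le {M N : Term 0} (h : ∀ φ, wp φ N ≤ wp φ M) (d : X → Value 0 → ℝ≥0∞)
    (μ : FinDist X) : err d μ M ≤ err d μ N :=
  err_le_iff.mpr fun φ b hb => (one_le_err_add hb N).trans (by gcongr; exact h φ)

theorem Step.err_le {M N : Term 0} (h : Step M (dirac N)) (d : X → Value 0 → ℝ≥0∞)
    (μ : FinDist X) : err d μ M ≤ err d μ N :=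
  err_le_of_wp_le h.wp_le_of_dirac d μ

theorem err_le_of_defect_le {d d' : X → Value 0 → ℝ≥0∞} {μ : FinDist X}
    (h : ∀ x ∈ μ.w.support, ∀ V, d x V ≤ d' x V) (M : Term 0) : err d μ M ≤ err d' μ M := by
  refine err_le_iff.mpr fun φ b hb => one_le_err_add (fun x hx V => ?_) M
  exact (hb x hx V).trans (by gcongr; exact h x hx V)

theorem err_pure_val {d : X → Value 0 → ℝ≥0∞} (hd : ∀ x V, d x V ≤ 1) (x : X) (V : Value 0) :
    err d (FinDist.pure x) (.val V) = d x V := by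
  have hx : ∀ y ∈ (FinDist.pure x).w.support, y = x := by
    intro y hy
    have h : y ∈ (Finsupp.single x (1 : ℝ≥0)).support := hy
    simpa using Finsupp.support_single_subset h
  refine le_antisymm (err_le_iff.mpr fun φ b hb => ?_) ?_
  · rw [wp_val, FinDist.integral_pure]
    refine hb x ?_ V
    change x ∈ (Finsupp.single x (1 : ℝ≥0)).support
    simp
  · -- The pair with `φ = 1 - d x` and `b = 0` is optimal.
    have h := one_le_err_add (d := d) (μ := FinDist.pure x) (φ := fun W => 1 - d x W)
      (b := fun _ => 0) (fun y hy W => by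
        rw [hx y hy, add_zero]
        exact le_add_tsub) (.val V)
    rw [wp_val, FinDist.integral_zero, add_zero] at h
    have h2 := tsub_le_iff_right.mpr h
    rwa [ENNReal.sub_sub_cancel ENNReal.one_ne_top (hd x V)] at h2

theorem err_le_of_lift {d : X → Value 0 → ℝ≥0∞} {R : X → X → Prop}
    (hR : ∀ x y, R x y → ∀ V, d y V ≤ d x V) {μ ν : FinDist X} (h : FinDist.Lift R μ ν)
    (M : Term 0) : err d ν M ≤ err d μ M := by
  obtain ⟨f, hf, hw⟩ := h
  refine err_le_iff.mpr fun φ b hb => ?_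
  refine (one_le_err_add (d := d) (μ := μ) (φ := φ) (b := fun x => b (f x))
    (fun x hx V => ?_) M).trans ?_
  · refine (hb (f x) (hf x hx).1 V).trans ?_
    gcongr
    exact hR x (f x) (hf x hx).2 V
  · gcongr
    exact FinDist.integral_comp_le (fun x hx => (hf x hx).1) hw b

theorem err_map {d : X → Value 0 → ℝ≥0∞} {d' : Y → Value 0 → ℝ≥0∞} {f : X → Y}
    (hd : ∀ x V, d' (f x) V = d x V) (μ : FinDist X) (M : Term 0) :
    err d' (μ.map f) M = err d μ M := by
  refine le_antisymm (err_le_iff.mpr fun φ b hb => ?_) (err_le_iff.mpr fun φ b hb => ?_)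
  · rw [FinDist.integral_map]
    refine one_le_err_add (fun x hx V => ?_) M
    rw [← hd]
    exact hb (f x) ((FinDist.mem_support_map f μ _).mpr ⟨x, hx, rfl⟩) V
  · -- The best potential on the image is the infimum of `b` over the fibres.
    let b' : Y → ℝ≥0∞ := fun y => ⨅ (x : X) (_ : x ∈ μ.w.support ∧ f x = y), b x
    refine (one_le_err_add (d := d') (μ := μ.map f) (φ := φ) (b := b') (fun y _ V => ?_)
      M).trans ?_
    · simp only [b', ENNReal.add_iInf, le_iInf_iff]
      rintro x ⟨hx, rfl⟩
      rw [hd]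
      exact hb x hx V
    · rw [FinDist.integral_map]
      gcongr
      exact FinDist.integral_mono fun x hx => iInf₂_le x ⟨hx, rfl⟩

theorem err_choice_le (d : X → Value 0 → ℝ≥0∞) (p : Set.Ioo (0 : ℝ≥0) 1) (μ ν : FinDist X)
    (M N : Term 0) : err d (μ.psum p ν) (.choice p M N) ≤
      ((p : ℝ≥0) : ℝ≥0∞) * err d μ M + ((1 - (p : ℝ≥0) : ℝ≥0) : ℝ≥0∞) * err d ν N := by
  refine err_le_iff.mpr fun φ b hb => ?_
  have h1 := one_le_err_add (d := d) (μ := μ) (φ := φ) (b := b)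
    (fun x hx => hb x ((FinDist.mem_support_psum p μ ν x).mpr (.inl hx))) M
  have h2 := one_le_err_add (d := d) (μ := ν) (φ := φ) (b := b)
    (fun x hx => hb x ((FinDist.mem_support_psum p μ ν x).mpr (.inr hx))) N
  rw [FinDist.integral_psum]
  calc (1 : ℝ≥0∞)
      = ((p : ℝ≥0) : ℝ≥0∞) * 1 + ((1 - (p : ℝ≥0) : ℝ≥0) : ℝ≥0∞) * 1 := by
        rw [mul_one, mul_one, coe_add_coe_one_sub]
    _ ≤ ((p : ℝ≥0) : ℝ≥0∞) * (err d μ M + (wp φ M + μ.integral b)) +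
          ((1 - (p : ℝ≥0) : ℝ≥0) : ℝ≥0∞) * (err d ν N + (wp φ N + ν.integral b)) := by
        gcongr
    _ = ((p : ℝ≥0) : ℝ≥0∞) * err d μ M + ((1 - (p : ℝ≥0) : ℝ≥0) : ℝ≥0∞) * err d ν N +
          (((p : ℝ≥0) : ℝ≥0∞) * wp φ M + ((1 - (p : ℝ≥0) : ℝ≥0) : ℝ≥0∞) * wp φ N +
          (((p : ℝ≥0) : ℝ≥0∞) * μ.integral b +
            ((1 - (p : ℝ≥0) : ℝ≥0) : ℝ≥0∞) * ν.integral b)) := by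
        ring
    _ ≤ _ := by
        gcongr
        exact le_wp_choice φ p M N

/-- Errors add up along sequencing. The continuation turns an admissible pair for its result into
one for `M`, whose potential at the type `x` also pays for the failure `c x` of the continuation
at `x`. -/
theorem err_letin_le {d : X → Value 0 → ℝ≥0∞} {d' : Y → Value 0 → ℝ≥0∞} {μ : FinDist X}
    {ν : X → FinDist Y} (c : X → ℝ≥0∞) (M : Term 0) (N : Term 1)
    (hN : ∀ x ∈ μ.w.support, ∀ V, err d' (ν x) (N.inst V) ≤ d x V + c x) :
    err d' (μ.bind ν) (.letin M N) ≤ err d μ M + μ.integral c := by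
  refine err_le_iff.mpr fun φ b hb => ?_
  have h := one_le_err_add (d := d) (μ := μ) (φ := fun V => wp φ (N.inst V))
    (b := fun x => (ν x).integral b + c x) (fun x hx V => ?_) M
  · rw [FinDist.integral_bind]
    refine h.trans ?_
    rw [FinDist.integral_add]
    calc _ = err d μ M + μ.integral c + (wp (fun V => wp φ (N.inst V)) M +
          μ.integral fun x => (ν x).integral b) := by ring
      _ ≤ _ := by
        gcongr
        exact wp_letin_le φ M N
  · have h2 := one_le_err_add (d := d') (μ := ν x) (φ := φ) (b := b)
      (fun y hy W => hb y (FinDist.mem_support_bind hx hy) W) (N.inst V)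
    calc (1 : ℝ≥0∞) ≤ err d' (ν x) (N.inst V) + (wp φ (N.inst V) + (ν x).integral b) := h2
      _ ≤ (d x V + c x) + (wp φ (N.inst V) + (ν x).integral b) := by gcongr; exact hN x hx V
      _ = _ := by ring

theorem isAST_of_err_eq_zero {d : X → Value 0 → ℝ≥0∞} {μ : FinDist X} {M : Term 0}
    (h : err d μ M = 0) : M.IsAST := by
  refine isAST_of_one_le_wp ?_
  have h2 := one_le_err_add (d := d) (μ := μ) (φ := fun _ => 1) (b := fun _ => 0)
    (fun x _ V => by simp) M
  simpa [h, FinDist.integral_zero] using h2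

end Err

/-- The numeral `Sᵐ 0`. -/
def numeral {n : ℕ} : ℕ → Value n
  | 0 => .zero
  | m + 1 => .succ (numeral m)

theorem numeral_isConstr {n : ℕ} (m : ℕ) : (numeral m : Value n).IsConstr := by
  cases m with
  | zero => exact .zero
  | succ m => exact .succ _

/-- The value of a size in a valuation of the size variables. -/
def Size.eval (ρ : ℕ → ℕ∞) : Size → ℕ∞
  | .var i k => ρ i + k
  | .infty => ⊤

open Classical in
/-- The failure, between `0` and `1`, of a closed value to have a sized type: a value of type
`Nat^s` is a numeral below the value of `s`, and a value of type `σ → μ` fails to the extent that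
applying it to an argument adds to the failure of the argument. -/
def defect (ρ : ℕ → ℕ∞) : {κ : SimpleTy} → SizedTy κ → Value 0 → ℝ≥0∞
  | .nat, s, V => if ∃ m : ℕ, (m : ℕ∞) < Size.eval ρ s ∧ V = numeral m then 0 else 1
  | .arr _ _, (σ, μ), V => ⨆ W, err (defect ρ) μ (.app V W) - defect ρ σ W

open Classical in
theorem defect_nat (ρ : ℕ → ℕ∞) (s : Size) (V : Value 0) : defect ρ (SizedTy.nat s) V =
    if ∃ m : ℕ, (m : ℕ∞) < s.eval ρ ∧ V = numeral m then 0 else 1 :=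
  rfl

theorem defect_arrow (ρ : ℕ → ℕ∞) {κ κ' : SimpleTy} (σ : SizedTy κ) (μ : DistTy κ')
    (V : Value 0) : defect ρ (SizedTy.arrow σ μ) V =
      ⨆ W, err (defect ρ) μ (.app V W) - defect ρ σ W :=
  rfl

theorem defect_nat_eq_zero {ρ : ℕ → ℕ∞} {s : Size} {m : ℕ} (h : (m : ℕ∞) < s.eval ρ) :
    defect ρ (SizedTy.nat s) (numeral m) = 0 := by
  rw [defect_nat, if_pos ⟨m, h, rfl⟩]

theorem defect_nat_cases (ρ : ℕ → ℕ∞) (s : Size) (V : Value 0) :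
    (∃ m : ℕ, (m : ℕ∞) < s.eval ρ ∧ V = numeral m) ∨ defect ρ (SizedTy.nat s) V = 1 := by
  by_cases h : ∃ m : ℕ, (m : ℕ∞) < s.eval ρ ∧ V = numeral m
  · exact .inl h
  · exact .inr (by rw [defect_nat, if_neg h])

theorem defect_arrow_le_iff {ρ : ℕ → ℕ∞} {κ κ' : SimpleTy} {σ : SizedTy κ} {μ : DistTy κ'}
    {V : Value 0} {a : ℝ≥0∞} : defect ρ (SizedTy.arrow σ μ) V ≤ a ↔
      ∀ W, err (defect ρ) μ (.app V W) ≤ a + defect ρ σ W := by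
  rw [defect_arrow]
  simp only [iSup_le_iff, tsub_le_iff_right]

theorem err_app_le (ρ : ℕ → ℕ∞) {κ κ' : SimpleTy} (σ : SizedTy κ) (μ : DistTy κ')
    (V W : Value 0) : err (defect ρ) μ (.app V W) ≤
      defect ρ (SizedTy.arrow σ μ) V + defect ρ σ W :=
  defect_arrow_le_iff.mp le_rfl W

theorem defect_arrow_nat_le_iff {ρ : ℕ → ℕ∞} {κ : SimpleTy} {s : Size} {μ : DistTy κ}
    {V : Value 0} {a : ℝ≥0∞} : defect ρ (SizedTy.arrow (SizedTy.nat s) μ) V ≤ a ↔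
      ∀ m : ℕ, (m : ℕ∞) < s.eval ρ → err (defect ρ) μ (.app V (numeral m)) ≤ a := by
  rw [defect_arrow_le_iff]
  constructor
  · intro h m hm
    have h2 := h (numeral m)
    rwa [defect_nat_eq_zero hm, add_zero] at h2
  · intro h W
    rcases defect_nat_cases ρ s W with ⟨m, hm, rfl⟩ | h1
    · exact (h m hm).trans le_self_add
    · rw [h1]
      exact (err_le_one _ _ _).trans le_add_self

theorem defect_le_one (ρ : ℕ → ℕ∞) {κ : SimpleTy} (σ : SizedTy κ) (V : Value 0) :
    defect ρ σ V ≤ 1 := by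
  match κ, σ with
  | .nat, s =>
    rw [defect]
    split_ifs <;> simp
  | .arr _ _, (σ, μ) =>
    exact defect_arrow_le_iff.mpr fun W => (err_le_one _ _ _).trans le_self_add

theorem err_defect_pure_val (ρ : ℕ → ℕ∞) {κ : SimpleTy} (σ : SizedTy κ) (V : Value 0) :
    err (defect ρ) (FinDist.pure σ) (.val V) = defect ρ σ V :=
  err_pure_val (fun σ V => defect_le_one ρ σ V) σ V

/-! ### Subtyping, size substitution and variance -/

theorem Size.eval_succ (ρ : ℕ → ℕ∞) (s : Size) : s.succ.eval ρ = s.eval ρ + 1 := by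
  cases s with
  | var i k => simp [Size.succ, Size.eval, add_assoc]
  | infty => simp [Size.succ, Size.eval]

theorem Size.Le.eval_le {s r : Size} (h : Size.Le s r) (ρ : ℕ → ℕ∞) : s.eval ρ ≤ r.eval ρ := by
  induction h with
  | refl => exact le_rfl
  | trans _ _ h1 h2 => exact h1.trans h2
  | succ s => rw [Size.eval_succ]; exact le_self_add
  | infty => exact le_top

theorem defect_nat_anti {ρ ρ' : ℕ → ℕ∞} {s r : Size} (h : s.eval ρ ≤ r.eval ρ') (V : Value 0) :
    defect ρ' (SizedTy.nat r) V ≤ defect ρ (SizedTy.nat s) V := by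
  rcases defect_nat_cases ρ s V with ⟨m, hm, rfl⟩ | h1
  · rw [defect_nat_eq_zero (hm.trans_le h)]
    exact zero_le
  · rw [h1]
    exact defect_le_one _ _ _

theorem defect_arrow_mono {ρ ρ' : ℕ → ℕ∞} {κ κ' : SimpleTy} {σ τ : SizedTy κ} {μ ν : DistTy κ'}
    (h1 : ∀ W, defect ρ σ W ≤ defect ρ' τ W)
    (h2 : ∀ M, err (defect ρ') ν M ≤ err (defect ρ) μ M) (V : Value 0) :
    defect ρ' (SizedTy.arrow τ ν) V ≤ defect ρ (SizedTy.arrow σ μ) V :=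
  defect_arrow_le_iff.mpr fun W => (h2 _).trans ((err_app_le ρ σ μ V W).trans (by
    gcongr; exact h1 W))

theorem SizedTy.Sub.defect_le (ρ : ℕ → ℕ∞) {κ : SimpleTy} {σ τ : SizedTy κ}
    (h : SizedTy.Sub σ τ) (V : Value 0) : defect ρ τ V ≤ defect ρ σ V := by
  induction κ generalizing V with
  | nat =>
    rw [SizedTy.Sub] at h
    exact defect_nat_anti (h.eval_le ρ) V
  | arr κ κ' ih1 ih2 =>
    obtain ⟨σ, μ⟩ := σ
    obtain ⟨τ, ν⟩ := τ
    rw [SizedTy.Sub] at h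
    exact defect_arrow_mono (fun W => ih1 h.1 W)
      (fun M => err_le_of_lift (R := SizedTy.Sub) (fun _ _ hR V => ih2 hR V) h.2 M) V

theorem DistTy.Sub.err_le (ρ : ℕ → ℕ∞) {κ : SimpleTy} {μ ν : DistTy κ} (h : DistTy.Sub μ ν)
    (M : Term 0) : err (defect ρ) ν M ≤ err (defect ρ) μ M :=
  err_le_of_lift (R := SizedTy.Sub) (fun _ _ hR V => hR.defect_le ρ V) h M

theorem Size.eval_iterate_succ (ρ : ℕ → ℕ∞) (s : Size) (k : ℕ) :
    (Size.succ^[k] s).eval ρ = s.eval ρ + k := by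
  induction k with
  | zero => simp
  | succ k ih => rw [Function.iterate_succ_apply', Size.eval_succ, ih]; simp [add_assoc]

theorem Size.eval_subst (ρ : ℕ → ℕ∞) (i : ℕ) (r s : Size) :
    (Size.subst i r s).eval ρ = s.eval (Function.update ρ i (r.eval ρ)) := by
  cases s with
  | infty => rfl
  | var j k =>
    by_cases h : j = i
    · subst h
      rw [Size.subst, if_pos rfl, Size.eval_iterate_succ, Size.eval, Function.update_self]
    · simp [Size.subst, Size.eval, h]

theorem defect_subst (ρ : ℕ → ℕ∞) (i : ℕ) (r : Size) {κ : SimpleTy} (σ : SizedTy κ)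
    (V : Value 0) :
    defect ρ (σ.subst i r) V = defect (Function.update ρ i (r.eval ρ)) σ V := by
  induction κ generalizing V with
  | nat =>
    rw [SizedTy.subst]
    exact le_antisymm (defect_nat_anti (Size.eval_subst ρ i r σ).ge V)
      (defect_nat_anti (Size.eval_subst ρ i r σ).le V)
  | arr κ κ' ih1 ih2 =>
    obtain ⟨σ, μ⟩ := σ
    rw [SizedTy.subst]
    exact le_antisymm
      (defect_arrow_mono (fun W => (ih1 σ W).ge)
        (fun M => (err_map (fun τ V => ih2 τ V) μ M).le) V)
      (defect_arrow_mono (fun W => (ih1 σ W).le)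
        (fun M => (err_map (fun τ V => ih2 τ V) μ M).ge) V)

theorem Size.eval_update_of_spine_ne {i : ℕ} {s : Size} (h : s.spine ≠ some i) (ρ : ℕ → ℕ∞)
    (a : ℕ∞) : s.eval (Function.update ρ i a) = s.eval ρ := by
  cases s with
  | infty => rfl
  | var j k =>
    have h : j ≠ i := fun e => h (by rw [e]; rfl)
    simp [Size.eval, h]

theorem Size.eval_update_mono {a b : ℕ∞} (h : a ≤ b) (i : ℕ) (s : Size) (ρ : ℕ → ℕ∞) :
    s.eval (Function.update ρ i a) ≤ s.eval (Function.update ρ i b) := by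
  cases s with
  | infty => exact le_rfl
  | var j k =>
    simp only [Size.eval]
    gcongr
    by_cases hj : j = i
    · subst hj; simpa
    · simp [hj]

theorem defect_update_mono (ρ : ℕ → ℕ∞) (i : ℕ) {a b : ℕ∞} (hab : a ≤ b) {κ : SimpleTy}
    (σ : SizedTy κ) (V : Value 0) :
    (SizedTy.Pos i σ →
      defect (Function.update ρ i b) σ V ≤ defect (Function.update ρ i a) σ V) ∧
    (SizedTy.Neg i σ →
      defect (Function.update ρ i a) σ V ≤ defect (Function.update ρ i b) σ V) := by
  induction κ generalizing V with
  | nat =>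
    refine ⟨fun _ => defect_nat_anti (Size.eval_update_mono hab i σ ρ) V, fun h => ?_⟩
    rw [SizedTy.Neg] at h
    refine defect_nat_anti (le_of_eq ?_) V
    rw [Size.eval_update_of_spine_ne h, Size.eval_update_of_spine_ne h]
  | arr κ κ' ih1 ih2 =>
    obtain ⟨σ, μ⟩ := σ
    constructor
    · intro h
      rw [SizedTy.Pos] at h
      exact defect_arrow_mono (fun W => (ih1 σ W).2 h.1)
        (fun M => err_le_of_defect_le (fun τ hτ V => (ih2 τ V).1 (h.2 τ hτ)) M) V
    · intro h
      rw [SizedTy.Neg] at h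
      exact defect_arrow_mono (fun W => (ih1 σ W).1 h.1)
        (fun M => err_le_of_defect_le (fun τ hτ V => (ih2 τ V).2 (h.2 τ hτ)) M) V

theorem DistTy.Pos.err_update_le {κ : SimpleTy} {i : ℕ} {ν : DistTy κ} (h : DistTy.Pos i ν)
    (ρ : ℕ → ℕ∞) {a b : ℕ∞} (hab : a ≤ b) (M : Term 0) :
    err (defect (Function.update ρ i b)) ν M ≤ err (defect (Function.update ρ i a)) ν M :=
  err_le_of_defect_le (fun τ hτ V => (defect_update_mono ρ i hab τ V).1 (h τ hτ)) M

/-! ### Sized walks -/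

/-- A bounded function that vanishes at `0` and does not decrease on average along an almost surely
terminating walk vanishes everywhere: its value at `m` is at most the probability that the walk
from `m` has not reached `0` after `k` steps, for every `k`. -/
theorem WalkAST.eq_zero_of_le_integral {w : FinDist ℕ} (hw : WalkAST w) {D : ℕ → ℝ≥0∞}
    (h0 : D 0 = 0) (h1 : ∀ m, D m ≤ 1)
    (h : ∀ m, D (m + 1) ≤ w.integral fun k => D (m + k)) (m : ℕ) : D m = 0 := by
  have key (k : ℕ) : ∀ m, D m + walkLaw w k m 0 ≤ 1 := by
    induction k with
    | zero =>
      intro m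
      rw [walkLaw, PMF.pure_apply]
      by_cases hm : 0 = m
      · subst hm; simp [h0]
      · simp [hm, h1 m]
    | succ k ih =>
      intro m
      cases m with
      | zero => rw [h0, zero_add]; exact PMF.coe_le_one _ _
      | succ m =>
        let g : Option ℕ → ℕ := fun o => o.elim 0 fun i => m + i
        have h2 : walkLaw w (k + 1) (m + 1) 0 = ∑' o, walkJump w o * walkLaw w k (g o) 0 := by
          rw [walkLaw, walkStep, PMF.bind_map, PMF.bind_apply]
          rfl
        have h3 : (w.integral fun k => D (m + k)) ≤ ∑' o, walkJump w o * D (g o) :=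
          (ENNReal.sum_le_tsum w.w.support).trans
            (ENNReal.tsum_comp_le_tsum_of_injective (Option.some_injective ℕ)
              fun o => walkJump w o * D (g o))
        calc D (m + 1) + walkLaw w (k + 1) (m + 1) 0
            ≤ ∑' o, walkJump w o * D (g o) + ∑' o, walkJump w o * walkLaw w k (g o) 0 := by
              rw [h2]
              gcongr
              exact (h m).trans h3
          _ = ∑' o, walkJump w o * (D (g o) + walkLaw w k (g o) 0) := by
              rw [← ENNReal.tsum_add]
              simp only [mul_add]
          _ ≤ ∑' o, walkJump w o :=
              ENNReal.tsum_le_tsum fun o => mul_le_of_le_one_right' (ih (g o))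
          _ = 1 := PMF.tsum_coe _
  have h2 : D m + ⨆ k, walkLaw w k m 0 ≤ 1 := by
    rw [ENNReal.add_iSup]
    exact iSup_le fun k => key k m
  rw [hw m] at h2
  have h3 := ENNReal.le_sub_of_add_le_right ENNReal.one_ne_top h2
  rwa [tsub_self, nonpos_iff_eq_zero] at h3

/-! ### Contexts -/

/-- The total failure of a closed substitution to have the types of a sized context. -/
def Ctx.defect {n : ℕ} (ρ : ℕ → ℕ∞) (Γ : Ctx n) (s : Fin n → Value 0) : ℝ≥0∞ :=
  ∑ x, (Γ x).elim 0 fun t => MAST.defect ρ t.2 (s x)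

/-- The average failure of a closed substitution to have the types of a distribution context. -/
def DCtx.defect {n : ℕ} (ρ : ℕ → ℕ∞) (Θ : DCtx n) (s : Fin n → Value 0) : ℝ≥0∞ :=
  Θ.elim 0 fun xμ => xμ.2.2.integral fun σ => MAST.defect ρ σ (s xμ.1)

section Contexts

variable {n : ℕ} (ρ : ℕ → ℕ∞) (s : Fin n → Value 0)

theorem Ctx.le_defect {Γ : Ctx n} {x : Fin n} {κ : SimpleTy} {σ : SizedTy κ}
    (h : Γ x = some ⟨κ, σ⟩) : MAST.defect ρ σ (s x) ≤ Γ.defect ρ s := by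
  have h2 := Finset.single_le_sum
    (f := fun x => (Γ x).elim 0 fun t => MAST.defect ρ t.2 (s x))
    (fun _ _ => zero_le) (Finset.mem_univ x)
  simp only [h] at h2
  exact h2

theorem Ctx.defect_cons (Γ : Ctx n) {κ : SimpleTy} (σ : SizedTy κ) (W : Value 0) :
    (Γ.cons σ).defect ρ (extSub W s) = MAST.defect ρ σ W + Γ.defect ρ s := by
  rw [Ctx.defect, Fin.sum_univ_succ]
  rfl

theorem Ctx.defect_weaken (Γ : Ctx n) (W : Value 0) :
    Γ.weaken.defect ρ (extSub W s) = Γ.defect ρ s := by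
  rw [Ctx.defect, Fin.sum_univ_succ]
  exact zero_add _

theorem DCtx.defect_weaken (Θ : DCtx n) (W : Value 0) :
    Θ.weaken.defect ρ (extSub W s) = Θ.defect ρ s := by
  cases Θ <;> rfl

theorem Ctx.defect_union {Γ Δ : Ctx n} (h : Γ.Disjoint Δ) :
    (Γ.union Δ).defect ρ s = Γ.defect ρ s + Δ.defect ρ s := by
  simp only [Ctx.defect, ← Finset.sum_add_distrib]
  refine Finset.sum_congr rfl fun x _ => ?_
  rcases h x with h | h <;> simp [Ctx.union, h]

theorem Ctx.Disjoint.union_left {Γ Δ Ξ : Ctx n} (h1 : Γ.Disjoint Ξ) (h2 : Δ.Disjoint Ξ) :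
    (Γ.union Δ).Disjoint Ξ := by
  intro x
  rcases h1 x with h | h
  · rcases h2 x with h' | h'
    · exact .inl (by simp [Ctx.union, h, h'])
    · exact .inr h'
  · exact .inr h

/-- Failures of type `Nat^s` are all or nothing, which is why variables of these types may be
used more than once. -/
theorem Ctx.IsNat.defect_eq_zero_or {Γ : Ctx n} (h : Γ.IsNat) :
    Γ.defect ρ s = 0 ∨ 1 ≤ Γ.defect ρ s := by
  by_cases h0 : ∃ x, ∃ t ∈ Γ x, MAST.defect ρ t.2 (s x) = 1
  · obtain ⟨x, t, ht, h1⟩ := h0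
    refine .inr (h1.ge.trans (Ctx.le_defect ρ s ht))
  · refine .inl (Finset.sum_eq_zero fun x _ => ?_)
    cases hx : Γ x with
    | none => rfl
    | some t =>
      have ht := h x t hx
      have h1 : ¬ MAST.defect ρ t.2 (s x) = 1 := fun h1 => h0 ⟨x, t, hx, h1⟩
      obtain ⟨κ, σ⟩ := t
      obtain rfl : κ = .nat := ht
      rcases defect_nat_cases ρ σ (s x) with ⟨m, hm, e⟩ | h2
      · exact (congrArg (MAST.defect ρ σ) e).trans (defect_nat_eq_zero hm)
      · exact absurd h2 h1

theorem Ctx.IsNat.defect_update {Γ : Ctx n} (h : Γ.IsNat) {i : ℕ} (hi : Γ.Fresh i) (a : ℕ∞) :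
    Γ.defect (Function.update ρ i a) s = Γ.defect ρ s := by
  refine Finset.sum_congr rfl fun x _ => ?_
  cases hx : Γ x with
  | none => rfl
  | some t =>
    have ht := h x t hx
    have hf := hi x t hx
    obtain ⟨κ, σ⟩ := t
    obtain rfl : κ = .nat := ht
    rw [SizedTy.Fresh] at hf
    have e := Size.eval_update_of_spine_ne hf ρ a
    exact le_antisymm (defect_nat_anti e.ge (s x)) (defect_nat_anti e.le (s x))

theorem DCtx.IsUnion.defect_eq {Θ Ψ Φ : DCtx n} (h : DCtx.IsUnion Θ Ψ Φ) :
    Φ.defect ρ s = Θ.defect ρ s + Ψ.defect ρ s := by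
  cases h with
  | left => exact (add_zero _).symm
  | right => exact (zero_add _).symm

theorem DCtx.IsPSum.defect_eq {p : Set.Ioo (0 : ℝ≥0) 1} {Θ Ψ Φ : DCtx n}
    (h : DCtx.IsPSum p Θ Ψ Φ) : Φ.defect ρ s =
      ((p : ℝ≥0) : ℝ≥0∞) * Θ.defect ρ s + ((1 - (p : ℝ≥0) : ℝ≥0) : ℝ≥0∞) * Ψ.defect ρ s := by
  cases h with
  | both x μ ν => exact FinDist.integral_psum p μ ν _
  | left x μ =>
    refine (FinDist.integral_scale _ p.2.1 p.2.2.le μ _).trans ?_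
    simp [DCtx.defect]
  | right x μ =>
    refine (FinDist.integral_scale _ (tsub_pos_of_lt p.2.2) tsub_le_self μ _).trans ?_
    simp [DCtx.defect]
  | empty => simp [DCtx.defect]

theorem DCtx.IsWSum.integral_defect_le {X : Type} {μ : FinDist X} {Ψ : X → DCtx n} {Φ : DCtx n}
    (h : DCtx.IsWSum μ Ψ Φ) : (μ.integral fun x => (Ψ x).defect ρ s) ≤ Φ.defect ρ s := by
  cases h with
  | some y ξ h =>
    refine le_trans (FinDist.integral_mono fun x hx => ?_) (FinDist.integral_bind μ ξ _).ge
    rw [h x hx]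
    rfl
  | empty h =>
    refine le_trans (FinDist.integral_mono fun x hx => ?_) (FinDist.integral_zero μ).le
    rw [h x hx]
    rfl

end Contexts

/-! ### Soundness of the typing rules -/

theorem SizedTy.subst_arrow_nat_var (i : ℕ) (r : Size) {κ : SimpleTy} (ν : DistTy κ) :
    (SizedTy.arrow (SizedTy.nat (.var i 0)) ν).subst i r =
      SizedTy.arrow (SizedTy.nat r) (DistTy.subst i r ν) := by
  have h : SizedTy.subst i r (SizedTy.nat (.var i 0)) = SizedTy.nat r :=
    if_pos rfl
  rw [← h]
  rfl

/-- A recursive definition whose body fails with at most the average failure of the recursive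
calls never fails, provided that the sized walk of these calls terminates almost surely. The
argument of the body is below `m + 1` when the size variable `i` has the value `m`; the value `∞`
of a size is reached from finite values by positivity. -/
theorem defect_letrec_eq_zero {κ : SimpleTy} {i : ℕ} {ν : DistTy κ} {μ : DistTy (.arr .nat κ)}
    (hν : DistTy.Pos i ν)
    (hμ : ∀ σ ∈ μ.w.support, ∃ s : Size, s.spine = some i ∧
      σ = SizedTy.arrow (SizedTy.nat s) (DistTy.subst i s ν))
    (hw : WalkAST μ.inducedWalk) (ρ : ℕ → ℕ∞) (V : Value 1)
    (hV : ∀ m : ℕ, defect (Function.update ρ i m)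
      (SizedTy.arrow (SizedTy.nat (Size.var i 0).succ) (DistTy.subst i (Size.var i 0).succ ν))
        (V.inst (.letrec V)) ≤
      μ.integral fun σ => defect (Function.update ρ i m) σ (.letrec V))
    (r : Size) : defect ρ (SizedTy.arrow (SizedTy.nat r) (DistTy.subst i r ν)) (.letrec V) = 0 := by
  -- `D a` is the failure of the recursive function when `i` has the value `a`.
  let T : SizedTy (.arr .nat κ) := SizedTy.arrow (SizedTy.nat (.var i 0)) ν
  let D : ℕ∞ → ℝ≥0∞ := fun a => defect (Function.update ρ i a) T (.letrec V)
  have eval_var (a : ℕ∞) : (Size.var i 0).eval (Function.update ρ i a) = a := by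
    simp [Size.eval]
  have defect_T (a : ℕ∞) (s : Size) (W : Value 0) :
      defect (Function.update ρ i a) (SizedTy.arrow (SizedTy.nat s) (DistTy.subst i s ν)) W =
        defect (Function.update ρ i (s.eval (Function.update ρ i a))) T W := by
    rw [← SizedTy.subst_arrow_nat_var, defect_subst, Function.update_idem]
  have step (m : ℕ) : D (m + 1 : ℕ) ≤ μ.inducedWalk.integral fun k => D (m + k : ℕ) := by
    have h1 : (μ.integral fun σ => defect (Function.update ρ i m) σ (.letrec V)) ≤
        μ.inducedWalk.integral fun k => D (m + k : ℕ) := by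
      rw [DistTy.inducedWalk, FinDist.integral_map]
      refine FinDist.integral_mono fun σ hσ => ?_
      obtain ⟨s, hs, rfl⟩ := hμ σ hσ
      rw [defect_T]
      cases s with
      | infty => simp [Size.spine] at hs
      | var j k =>
        obtain rfl : j = i := by simpa [Size.spine] using hs
        refine le_of_eq ?_
        have e : (Size.var j k).eval (Function.update ρ j (m : ℕ∞)) = ((m + k : ℕ) : ℕ∞) := by
          simp [Size.eval]
        rw [e]
        rfl
    have h2 := (hV m).trans h1
    rw [defect_T, Size.eval_succ, eval_var] at h2
    refine defect_arrow_nat_le_iff.mpr fun k hk => ?_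
    refine (Step.unfold V (numeral k) (numeral_isConstr k)).err_le _ _ |>.trans ?_
    have h3 := defect_arrow_nat_le_iff.mp h2 k
    rw [eval_var] at h3 hk
    push_cast at hk ⊢
    exact h3 hk
  have D_nat (m : ℕ) : D m = 0 := by
    refine hw.eq_zero_of_le_integral (D := fun m => D m) ?_ (fun m => defect_le_one _ _ _) step m
    refine le_antisymm (defect_arrow_nat_le_iff.mpr fun k hk => ?_) zero_le
    rw [eval_var] at hk
    simp at hk
  have D_top : D ⊤ = 0 := by
    refine le_antisymm (defect_arrow_nat_le_iff.mpr fun k _ => ?_) zero_le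
    refine (hν.err_update_le ρ (a := (k + 1 : ℕ)) le_top _).trans ?_
    refine defect_arrow_nat_le_iff.mp (D_nat (k + 1)).le k ?_
    rw [eval_var]
    exact_mod_cast Nat.lt_succ_self k
  rw [← SizedTy.subst_arrow_nat_var, defect_subst]
  induction r.eval ρ using ENat.recTopCoe with
  | top => exact D_top
  | coe m => exact D_nat m

/-- The failure of a typable term is at most the sum of the failures of the values substituted
for its variables. -/
theorem HasType.err_le {n : ℕ} {Γ : Ctx n} {Θ : DCtx n} {M : Term n} {κ : SimpleTy}
    {μ : DistTy κ} (h : HasType Γ Θ M μ) (ρ : ℕ → ℕ∞) (s : Fin n → Value 0) :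
    err (defect ρ) μ (M.subst s) ≤ Γ.defect ρ s + Θ.defect ρ s := by
  induction h generalizing ρ with
  | var Γ Θ x σ _ hx =>
    rw [Term.subst, Value.subst, err_defect_pure_val]
    exact (Ctx.le_defect ρ s hx).trans le_self_add
  | var' Γ x σ _ =>
    rw [Term.subst, Value.subst, err_defect_pure_val]
    exact le_add_left (FinDist.integral_pure σ _).ge
  | succ Γ Θ V r _ ih =>
    have h := ih ρ s
    rw [Term.subst, err_defect_pure_val] at h
    rw [Term.subst, Value.subst, err_defect_pure_val]
    refine le_trans ?_ h
    rcases defect_nat_cases ρ r (V.subst s) with ⟨m, hm, e⟩ | h1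
    · have hm' : ((m + 1 : ℕ) : ℕ∞) < r.succ.eval ρ := by
        rw [Size.eval_succ, Nat.cast_succ]
        exact (ENat.add_lt_add_iff_right ENat.one_ne_top).mpr hm
      rw [e]
      exact (defect_nat_eq_zero hm').trans_le zero_le
    · rw [h1]
      exact defect_le_one _ _ _
  | zero Γ Θ r _ =>
    rw [Term.subst, Value.subst, err_defect_pure_val]
    have h0 : ((0 : ℕ) : ℕ∞) < r.succ.eval ρ := by
      rw [Size.eval_succ]
      simp
    exact (defect_nat_eq_zero h0).trans_le zero_le
  | lam Γ Θ M σ μ _ ih =>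
    rw [Term.subst, Value.subst, err_defect_pure_val]
    refine defect_arrow_le_iff.mpr fun W => ?_
    refine ((Step.beta (M.subst (liftSub s)) W).err_le _ _).trans ?_
    rw [Term.inst_subst_liftSub]
    refine (ih ρ (extSub W s)).trans (le_of_eq ?_)
    rw [Ctx.defect_cons, DCtx.defect_weaken]
    ring
  | sub Γ Θ M μ ν _ hs ih => exact (hs.err_le ρ _).trans (ih ρ s)
  | app Γ Δ Ξ Θ Ψ Φ V W σ μ h1 h2 h3 hN hΦ _ _ _ ihV ihW =>
    have hV := ihV ρ s
    have hW := ihW ρ s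
    rw [Term.subst, err_defect_pure_val, Ctx.defect_union ρ s h1] at hV
    rw [Term.subst, err_defect_pure_val, Ctx.defect_union ρ s h2] at hW
    rw [Term.subst, Ctx.defect_union ρ s (h2.union_left h3), Ctx.defect_union ρ s h1,
      hΦ.defect_eq]
    rcases hN.defect_eq_zero_or ρ s with h0 | h0
    · refine (err_app_le ρ σ μ _ _).trans ((add_le_add hV hW).trans (le_of_eq ?_))
      rw [h0]
      ring
    · exact (err_le_one _ _ _).trans (h0.trans (by rw [add_assoc, add_assoc]; exact le_self_add))
  | choice Γ Θ Ψ Φ p M N μ ν hΦ _ _ ihM ihN =>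
    rw [Term.subst, hΦ.defect_eq]
    refine (err_choice_le _ p μ ν _ _).trans ?_
    have hM := ihM ρ s
    have hN := ihN ρ s
    calc _ ≤ ((p : ℝ≥0) : ℝ≥0∞) * (Γ.defect ρ s + Θ.defect ρ s) +
          ((1 - (p : ℝ≥0) : ℝ≥0) : ℝ≥0∞) * (Γ.defect ρ s + Ψ.defect ρ s) := by gcongr
      _ = (((p : ℝ≥0) : ℝ≥0∞) + ((1 - (p : ℝ≥0) : ℝ≥0) : ℝ≥0∞)) * Γ.defect ρ s +
          (((p : ℝ≥0) : ℝ≥0∞) * Θ.defect ρ s +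
            ((1 - (p : ℝ≥0) : ℝ≥0) : ℝ≥0∞) * Ψ.defect ρ s) := by ring
      _ = _ := by rw [coe_add_coe_one_sub, one_mul]
  | letin Γ Δ Ξ Θ Ψ Ψ' Φ M N μ ν h1 h2 h3 hN hΨ hΦ _ _ _ ihM ihN =>
    have hM := ihM ρ s
    rw [Ctx.defect_union ρ s h1] at hM
    rw [Term.subst, Ctx.defect_union ρ s (h2.union_left h3), Ctx.defect_union ρ s h1,
      hΦ.defect_eq]
    rcases hN.defect_eq_zero_or ρ s with h0 | h0
    · refine (err_letin_le (d := defect ρ) (d' := defect ρ)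
        (fun σ => Ξ.defect ρ s + (Ψ σ).defect ρ s) _ _ fun σ hσ V => ?_).trans ?_
      · rw [Term.inst_subst_liftSub]
        refine (ihN σ hσ ρ (extSub V s)).trans (le_of_eq ?_)
        rw [Ctx.defect_cons, DCtx.defect_weaken, Ctx.defect_union ρ s h2, h0]
        ring
      · rw [FinDist.integral_add]
        refine (add_le_add hM (add_le_add (FinDist.integral_const_le μ _)
          (hΨ.integral_defect_le ρ s))).trans (le_of_eq ?_)
        ring
    · exact (err_le_one _ _ _).trans (h0.trans (by rw [add_assoc, add_assoc]; exact le_self_add))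
  | case Γ Δ Θ V W Z r μ h1 _ _ _ _ ihV ihW ihZ =>
    have hV := ihV ρ s
    have hW := ihW ρ s
    have hZ := ihZ ρ s
    rw [Term.subst, err_defect_pure_val] at hV hW
    rw [Term.subst] at hZ
    rw [Term.subst, Ctx.defect_union ρ s h1, add_assoc]
    rcases defect_nat_cases ρ r.succ (V.subst s) with ⟨m, hm, e⟩ | h1
    · rw [e]
      refine le_trans ?_ le_add_self
      cases m with
      | zero => exact ((Step.case_zero _ _).err_le _ _).trans hZ
      | succ m =>
        rw [Size.eval_succ, Nat.cast_succ] at hm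
        have hm' := (ENat.add_lt_add_iff_right ENat.one_ne_top).mp hm
        exact ((Step.case_succ _ _ _).err_le _ _).trans (defect_arrow_nat_le_iff.mp hW m hm')
    · rw [h1] at hV
      exact (err_le_one _ _ _).trans (hV.trans (by simp [DCtx.defect]))
  | letrec Γ Δ Θ V i ν μ r h1 _ hN hF hν hμ hw _ ih =>
    rw [Term.subst, Value.subst, err_defect_pure_val, Ctx.defect_union ρ s h1]
    rcases hN.defect_eq_zero_or ρ s with h0 | h0
    · refine (defect_letrec_eq_zero hν hμ hw ρ _ (fun m => ?_) r).trans_le zero_le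
      have h := ih (Function.update ρ i m) (extSub (.letrec (V.subst (liftSub s))) s)
      rw [Term.subst, err_defect_pure_val, Ctx.defect_weaken, hN.defect_update ρ s hF, h0] at h
      rw [Value.inst_subst_liftSub]
      exact h.trans (zero_add _).le
    · exact (defect_le_one _ _ _).trans (h0.trans (by rw [add_assoc]; exact le_self_add))

end

end MAST

theorem mainTheorem1 {κ : MAST.SimpleTy} (μ : MAST.DistTy κ) (M : MAST.Term 0)
    (hM : MAST.HasType MAST.Ctx.empty MAST.DCtx.empty M μ) : M.IsAST := by
  have h := hM.err_le (fun _ => 0) MAST.Value.var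
  rw [MAST.Term.subst_var] at h
  refine MAST.isAST_of_err_eq_zero (le_antisymm (h.trans (le_of_eq ?_)) zero_le)
  simp [MAST.Ctx.defect, MAST.DCtx.defect, MAST.DCtx.empty]
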